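/- Trees are plane trees whose edges are labelled by an alphabet $\Sigma$: a rooted tree has an ordered list of children at every node, an unrooted tree has a cyclic order of the neighbours of every node, and a rooting of an unrooted tree is a choice of a root and of the leftmost edge from the root. Let $c_{del}(\alpha)\in[0,\infty]$ be the cost of contracting or uncontracting an edge labelled $\alpha$ and $c_{match}(\alpha,\beta)=c_{match}(\beta,\alpha)\in[0,\infty]$ the cost of matching an edge labelled $\alpha$ with one labelled $\beta$. A solution for two rooted trees contracts some edges of each of them so that the two resulting trees are equal up to labels; corresponding remaining edges are matched; its cost is the sum of the costs of all contractions and matchings. The (rooted) edit distance is the minimum cost of a solution. A solution for two unrooted trees is a rooting of each of them together with a solution for the rooted trees; the unrooted edit distance is the minimum cost over all rootings. TED is the problem of computing the edit distance. The size of a tree is its number of nodes. **(1) Reduction.** Let $T_1,T_2$ be rooted trees over $\Sigma$, with costs as above. Let $\$\notin\Sigma$ be a fresh label, put $c_{del}(\$)=\infty$, $c_{match}(\$,\$)=0$ and $c_{match}(\$,\alpha)=\infty$ for $\alpha\in\Sigma$, and let $T_i'$ be the unrooted tree that is obtained from $T_i$ by adding one edge labelled $\$$ between the root and a new node. Then the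 unrooted edit distance of $T_1',T_2'$ equals the rooted edit distance of $T_1,T_2$. Moreover, in every optimal solution of finite cost for the unrooted trees $T_1',T_2'$, the two edges labelled $\$$ are matched with each other, and, after re-rooting both trees at the new nodes, deleting these two edges leaves an optimal solution for the rooted trees $T_1,T_2$ of the same cost and with the same contracted edges and, as a multiset of label pairs, the same other matched pairs. **(2) Decomposition algorithms.** For a rooted tree $F$, a side (left or right) and the main edge $e$ of $F$ of this side (the leftmost or the rightmost edge from the root), let $F-e$ be the result of contracting $e$, let $F_e$ be the subtree under $e$, and let $F-F_e$ be the result of contracting $e$ and all edges of $F_e$. A decomposition algorithm for unrooted TED computes, for some pairs of rootings of the two input trees that suffice to obtain the unrooted edit distance as the minimum, the rooted edit distances by the recursion $$\delta(F,G)=\min\{\delta(F-e,G)+c_{del}(e),\ \delta(F,G-f)+c_{del}(f),\ \delta(F_e,G_f)+\delta(F-F_e,G-G_f)+c_{match}(e,f)\},$$ where $e,f$ are the main edges of $F,G$ of the same side, and this side is chosen by an arbitrary strategy that depends on the input and on $(F,G)$; the distances from and to the one-node tree are known in advance. Its relevant subproblems are the different pairs $(F,G)$ of trees with at least one edge that this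 recursion meets, and they bound its running time from below. There are constants $c_1,c_2,c_3>0$ such that for every decomposition algorithm for unrooted TED and all $n\ge m\ge1$ there are trees of sizes between $c_1n$ and $c_2n$, and between $c_1m$ and $c_2m$, on which the algorithm has at least $c_3\,m^2n\,(1+\log\frac nm)$ relevant subproblems. **(3) All lower bounds for rooted TED carry over.** Consider algorithms on a word RAM (words of $\Omega(\log N)$ bits, where $N$ is the length of the input plus its largest entry), integer costs that are infinite or at most $n^d$ for a constant $d$, and trees of which the larger one has $n$ nodes. Let $f,g:\mathbb N\to\mathbb N$ with $g(n+1)\ge f(n)+1$ for all $n$, and let $t\ge0$. If unrooted TED with alphabets of size at most $g(n)$ can be solved in time $O(t(n))$, then rooted TED with alphabets of size at most $f(n)$ can be solved in time $O(t(n+1)+n+f(n))$. In particular, say that TED is truly subcubic for some alphabet size if for every $d$ it can be solved in time $O(n^{3-\varepsilon})$ for some $\varepsilon>0$. For every constant $k\ge1$: if unrooted TED with $|\Sigma|\le kn$ is truly subcubic, then so is rooted TED with $|\Sigma|\le kn$. For every constant $k$: if unrooted TED with $|\Sigma|\le k+1$ is truly subcubic, then so is rooted TED with $|\Sigma|\le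 k$. Consequently the conditional lower bounds for rooted TED carry over to unrooted TED: * for every $k\ge1$, if a truly subcubic algorithm for rooted TED with $|\Sigma|\le kn$ implies a truly subcubic algorithm for APSP (on directed graphs without negative cycles, with polynomially bounded integer weights), then a truly subcubic algorithm for unrooted TED with $|\Sigma|\le kn$ implies one as well; * for every $k$, if a truly subcubic algorithm for rooted TED with $|\Sigma|\le k$ implies, for every $d$, that for some $\varepsilon>0$ and all sufficiently large $l$ Max-Weight $l$-Clique with integer weights at most $n^{dl}$ can be solved in time $O(n^{l(1-\varepsilon)})$, then a truly subcubic algorithm for unrooted TED with $|\Sigma|\le k+1$ implies the same. -/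

import Mathlib

open scoped ENNReal

namespace TreeEdit

universe u v

/-! ### Rooted and unrooted edge-labelled plane trees -/

/-- A rooted plane tree with edges labelled by `α`.  `leaf` is the one-node tree.  In
`cons a s r` the leftmost edge from the root has label `a`, `s` is the rooted tree hanging below
that edge, and `r` (which has the same root) consists of all the other edges, in their
left-to-right order. -/
inductive RTree (α : Type u) : Type u
  | leaf : RTree α
  | cons (a : α) (s r : RTree α) : RTree α

namespace RTree

variable {α : Type u} {β : Type v}

/-- Relabelling of all edges by a function. -/
def map (f : α → β) : RTree α → RTree β
  | leaf => leaf
  | cons a s r => cons (f a) (s.map f) (r.map f)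

/-- Gluing two rooted trees at their roots, the first one to the left of the second one. -/
def append : RTree α → RTree α → RTree α
  | leaf, t => t
  | cons a s r, t => cons a s (r.append t)

/-- The labels of all edges (in preorder). -/
def labels : RTree α → List α
  | leaf => []
  | cons a s r => a :: (s.labels ++ r.labels)

/-- The number of edges. -/
def edges : RTree α → ℕ
  | leaf => 0
  | cons _ s r => s.edges + 1 + r.edges

/-- The size of a tree: its number of nodes. -/
def nodes (t : RTree α) : ℕ := t.edges + 1

/-- Two elementary changes of the rooting of a plane tree.  `rotate`: the root stays, the second
edge from the root (in the cyclic order) becomes the leftmost one.  `cross`: the root moves to the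
other end of the leftmost edge, and that edge becomes the leftmost edge of the new root; the
edges that follow it in the cyclic order around the new root are those of `s`, and the edges that
follow it around the old root are those of `r`. -/
inductive RerootStep : RTree α → RTree α → Prop
  | rotate (a : α) (s r : RTree α) : RerootStep (cons a s r) (r.append (cons a s leaf))
  | cross (a : α) (s r : RTree α) : RerootStep (cons a s r) (cons a r s)

/-- Two rooted plane trees are related if they are rootings of the same unrooted plane tree. -/
def rerootSetoid (α : Type u) : Setoid (RTree α) := Relation.EqvGen.setoid RerootStep

end RTree

open RTree

/-- Unrooted edge-labelled plane trees (with a cyclic order of the neighbours of every node): a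
rooted plane tree, up to the choice of the root and of the leftmost edge from the root. -/
def UTree (α : Type u) : Type u := Quotient (rerootSetoid α)

/-- Forgetting the root and the leftmost edge.  The rootings of an unrooted tree `U` are the
rooted trees `T` with `unroot T = U`. -/
def unroot {α : Type u} (t : RTree α) : UTree α := Quotient.mk (rerootSetoid α) t

/-! ### Edit distance -/

/-- Costs of the elementary operations: `del a` is the cost of contracting or uncontracting an edge
with label `a`, and `mtch a b` is the cost of changing the label `a` into `b`. -/
structure Costs (α : Type u) where
  del : α → ℝ≥0∞
  mtch : α → α → ℝ≥0∞
  mtch_symm : ∀ a b, mtch a b = mtch b a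

/-- A tree in which every edge carries, besides its label, the decision whether it is contracted
(`true`) or kept (`false`). -/
abbrev Marked (α : Type u) := RTree (α × Bool)

section Solutions

variable {α : Type u}

/-- The tree obtained by contracting all edges that are marked as contracted. -/
def contract : Marked α → RTree α
  | leaf => leaf
  | cons (_, true) s r => (contract s).append (contract r)
  | cons (a, false) s r => cons a (contract s) (contract r)

/-- The labels of the contracted edges. -/
def contracted : Marked α → List α
  | leaf => []
  | cons (a, true) s r => a :: (contracted s ++ contracted r)
  | cons (_, false) s r => contracted s ++ contracted r

/-- Equality of rooted plane trees up to labels. -/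
def SameShape (s t : RTree α) : Prop := s.map (fun _ => ()) = t.map (fun _ => ())

/-- The pairs of labels of corresponding edges of two rooted trees of the same shape. -/
def pairs : RTree α → RTree α → List (α × α)
  | cons a s r, cons b s' r' => (a, b) :: (pairs s s' ++ pairs r r')
  | _, _ => []

/-- The pairs of labels of the edges that are matched with each other. -/
def matched (M N : Marked α) : List (α × α) := pairs (contract M) (contract N)

/-- The total cost of transforming both trees to a common tree. -/
noncomputable def editCost (c : Costs α) (M N : Marked α) : ℝ≥0∞ :=
  ((contracted M).map c.del).sum + ((contracted N).map c.del).sum +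
    ((matched M N).map fun p => c.mtch p.1 p.2).sum

/-- Solutions of the rooted problem: in each tree some edges are contracted, such that the two
resulting trees are equal after relabelling. -/
def IsRootedSolution (S T : RTree α) (M N : Marked α) : Prop :=
  M.map Prod.fst = S ∧ N.map Prod.fst = T ∧ SameShape (contract M) (contract N)

/-- Solutions of the unrooted problem: a choice of rootings of both trees, together with a solution
for the rooted trees. -/
def IsUnrootedSolution (U V : UTree α) (M N : Marked α) : Prop :=
  ∃ S T : RTree α, unroot S = U ∧ unroot T = V ∧ IsRootedSolution S T M N

/-- Edit distance of rooted trees. -/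
noncomputable def rootedDist (c : Costs α) (S T : RTree α) : ℝ≥0∞ :=
  ⨅ (M : Marked α) (N : Marked α) (_ : IsRootedSolution S T M N), editCost c M N

/-- Edit distance of unrooted trees: the minimum over all rootings of both trees. -/
noncomputable def unrootedDist (c : Costs α) (U V : UTree α) : ℝ≥0∞ :=
  ⨅ (S : RTree α) (T : RTree α) (_ : unroot S = U) (_ : unroot T = V), rootedDist c S T

def IsOptimalRooted (c : Costs α) (S T : RTree α) (M N : Marked α) : Prop :=
  IsRootedSolution S T M N ∧
    ∀ M' N' : Marked α, IsRootedSolution S T M' N' → editCost c M N ≤ editCost c M' N'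

def IsOptimalUnrooted (c : Costs α) (U V : UTree α) (M N : Marked α) : Prop :=
  IsUnrootedSolution U V M N ∧
    ∀ M' N' : Marked α, IsUnrootedSolution U V M' N' → editCost c M N ≤ editCost c M' N'

end Solutions

/-! ### The gadget

The fresh label `$` is `none : Option α`; the old labels are `some a`. -/

/-- The extended costs: `$` cannot be contracted and can only be matched with `$`. -/
def gadgetCosts {α : Type u} (c : Costs α) : Costs (Option α) where
  del
    | none => ⊤
    | some a => c.del a
  mtch
    | none, none => 0
    | none, some _ => ⊤
    | some _, none => ⊤
    | some a, some b => c.mtch a b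
  mtch_symm := by
    rintro (_ | a) (_ | b)
    · rfl
    · rfl
    · rfl
    · exact c.mtch_symm a b

/-- One edge with label `$` is added between the root and a new node; rooted at the new node. -/
def gadget {α : Type u} (t : RTree α) : RTree (Option α) := cons none (t.map some) leaf

/-- The gadget for marked trees; the new edge is kept. -/
def markedGadget {α : Type u} (M : Marked α) : Marked (Option α) :=
  cons (none, false) (M.map (Prod.map some id)) leaf

/-! ### Decomposition algorithms -/

/-- The direction: the left or the right main edge. -/
inductive Side
  | left
  | right

section Decomposition

variable {α : Type u}

/-- The subtree under the right main edge (`leaf` for the one-node tree). -/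
def underRight : RTree α → RTree α
  | leaf => leaf
  | cons _ s leaf => s
  | cons _ _ (cons b s r) => underRight (cons b s r)

/-- The tree without its right main edge and the subtree under it. -/
def restRight : RTree α → RTree α
  | leaf => leaf
  | cons _ _ leaf => leaf
  | cons a s (cons b s' r) => cons a s (restRight (cons b s' r))

/-- `L_F` or `R_F`: the subtree under the main edge of the given side. -/
def under : Side → RTree α → RTree α
  | .left, leaf => leaf
  | .left, cons _ s _ => s
  | .right, t => underRight t

/-- `F - L_F` or `F - R_F`: the main edge and all edges below it are contracted. -/
def rest : Side → RTree α → RTree α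
  | .left, leaf => leaf
  | .left, cons _ _ r => r
  | .right, t => restRight t

/-- `F - l_F` or `F - r_F`: the main edge of the given side is contracted. -/
def contractMain : Side → RTree α → RTree α
  | .left, t => (under .left t).append (rest .left t)
  | .right, t => (rest .right t).append (under .right t)

/-- `Relevant σ S T F G`: the pair `(F, G)` is a subproblem that is met when `δ(S, T)` is computed by
the recursion
`δ(F,G) = min (δ(F-e,G) + c_del e) (δ(F,G-f) + c_del f) (δ(F_e,G_f) + δ(F-F_e,G-G_f) + c_match e f)`
where `e`, `f` are the main edges of `F`, `G` of the side `σ F G`, and `F_e`, `G_f` are the subtrees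
under them.  The values with `F` or `G` empty are known in advance, so there is no recursion from
such a pair. -/
inductive Relevant (σ : RTree α → RTree α → Side) (S T : RTree α) : RTree α → RTree α → Prop
  | start : Relevant σ S T S T
  | contractFst {F G : RTree α} : Relevant σ S T F G → F ≠ leaf → G ≠ leaf →
      Relevant σ S T (contractMain (σ F G) F) G
  | contractSnd {F G : RTree α} : Relevant σ S T F G → F ≠ leaf → G ≠ leaf →
      Relevant σ S T F (contractMain (σ F G) G)
  | matchUnder {F G : RTree α} : Relevant σ S T F G → F ≠ leaf → G ≠ leaf →
      Relevant σ S T (under (σ F G) F) (under (σ F G) G)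
  | matchRest {F G : RTree α} : Relevant σ S T F G → F ≠ leaf → G ≠ leaf →
      Relevant σ S T (rest (σ F G) F) (rest (σ F G) G)

/-- A decomposition algorithm for unrooted trees.  On every input `U`, `V` it computes, by the above
recursion and with some strategy for the choice of the sides, the rooted edit distances for some
pairs of rootings of `U` and `V` (for instance for one rooting of `U` and all rootings of `V`) whose
minimum always is the unrooted edit distance. -/
structure UnrootedDecomposition (α : Type u) where
  rootings : UTree α → UTree α → Set (RTree α × RTree α)
  unroot_rootings : ∀ U V, ∀ p ∈ rootings U V, unroot p.1 = U ∧ unroot p.2 = V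
  correct : ∀ (c : Costs α) (U V : UTree α),
    ⨅ p ∈ rootings U V, rootedDist c p.1 p.2 = unrootedDist c U V
  strategy : UTree α → UTree α → RTree α → RTree α → Side

/-- The relevant subproblems (with both trees non-empty) of a decomposition algorithm on an input
with trees `U`, `V`.  For trees with pairwise distinct edge labels, a pruned subtree is determined by
its labels, so that these are the different pairs of pruned subtrees of `U` and `V` whose distance
is computed. -/
def UnrootedDecomposition.subproblems (A : UnrootedDecomposition α) (U V : UTree α) :
    Set (RTree α × RTree α) :=
  {q | q.1 ≠ leaf ∧ q.2 ≠ leaf ∧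
    ∃ p ∈ A.rootings U V, Relevant (A.strategy U V) p.1 p.2 q.1 q.2}

end Decomposition

/-! ### Word RAM -/

/-- Operations on words. -/
inductive BinOp
  | add | sub | mul | div | mod | and | or | xor | shl | shr | lt | eq

/-- The operations on words of `W` bits; the result is reduced modulo `2 ^ W`. -/
def BinOp.eval (W : ℕ) (o : BinOp) (x y : ℕ) : ℕ :=
  (match o with
    | add => x + y
    | sub => x + 2 ^ W - y
    | mul => x * y
    | div => x / y
    | mod => x % y
    | and => x &&& y
    | or => x ||| y
    | xor => x ^^^ y
    | shl => x * 2 ^ y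
    | shr => x / 2 ^ y
    | lt => if x < y then 1 else 0
    | eq => if x = y then 1 else 0) % 2 ^ W

/-- Programs of a word RAM with registers and a fixed finite number of arrays (the numbers of the
registers and arrays are constants of the program; the index of an array cell is taken from a
register). -/
inductive Program
  | const (dst val : ℕ)
  | op (o : BinOp) (dst x y : ℕ)
  | load (dst arr idx : ℕ)
  | store (arr idx src : ℕ)
  | seq (p q : Program)
  | ifNonzero (r : ℕ) (p q : Program)
  | whileNonzero (r : ℕ) (p : Program)

/-- Contents of the registers and of the arrays. -/
structure RAMState where
  reg : ℕ → ℕ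
  mem : ℕ → ℕ → ℕ

def RAMState.setReg (s : RAMState) (r x : ℕ) : RAMState :=
  { s with reg := Function.update s.reg r x }

def RAMState.setMem (s : RAMState) (a i x : ℕ) : RAMState :=
  { s with mem := Function.update s.mem a (Function.update (s.mem a) i x) }

/-- `Exec W p s t s'`: with words of `W` bits, the program `p` started in the state `s` halts after
exactly `t` steps in the state `s'`.  Every instruction and every test is one step. -/
inductive Exec (W : ℕ) : Program → RAMState → ℕ → RAMState → Prop
  | const (dst val : ℕ) (s : RAMState) :
      Exec W (.const dst val) s 1 (s.setReg dst (val % 2 ^ W))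
  | op (o : BinOp) (dst x y : ℕ) (s : RAMState) :
      Exec W (.op o dst x y) s 1 (s.setReg dst (o.eval W (s.reg x) (s.reg y)))
  | load (dst arr idx : ℕ) (s : RAMState) :
      Exec W (.load dst arr idx) s 1 (s.setReg dst (s.mem arr (s.reg idx)))
  | store (arr idx src : ℕ) (s : RAMState) :
      Exec W (.store arr idx src) s 1 (s.setMem arr (s.reg idx) (s.reg src))
  | seq {p q : Program} {s₀ s₁ s₂ : RAMState} {t₁ t₂ : ℕ} :
      Exec W p s₀ t₁ s₁ → Exec W q s₁ t₂ s₂ → Exec W (.seq p q) s₀ (t₁ + t₂) s₂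
  | ifTrue {r : ℕ} {p q : Program} {s s' : RAMState} {t : ℕ} :
      s.reg r ≠ 0 → Exec W p s t s' → Exec W (.ifNonzero r p q) s (t + 1) s'
  | ifFalse {r : ℕ} {p q : Program} {s s' : RAMState} {t : ℕ} :
      s.reg r = 0 → Exec W q s t s' → Exec W (.ifNonzero r p q) s (t + 1) s'
  | whileTrue {r : ℕ} {p : Program} {s₀ s₁ s₂ : RAMState} {t₁ t₂ : ℕ} :
      s₀.reg r ≠ 0 → Exec W p s₀ t₁ s₁ → Exec W (.whileNonzero r p) s₁ t₂ s₂ →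
      Exec W (.whileNonzero r p) s₀ (t₁ + t₂ + 1) s₂
  | whileFalse {r : ℕ} {p : Program} {s : RAMState} :
      s.reg r = 0 → Exec W (.whileNonzero r p) s 1 s

/-- The initial state for an input that consists of finitely many arrays: the `k`-th array holds the
`k`-th list, the `k`-th register holds its length, and everything else is zero. -/
def initState (xs : List (List ℕ)) : RAMState where
  reg k := (xs.getD k []).length
  mem k i := (xs.getD k []).getD i 0

/-- The total length of an input plus its largest entry. -/
def magnitude (xs : List (List ℕ)) : ℕ := xs.flatten.length + xs.flatten.foldr max 0

/-- A computational problem: its inputs, their presentation to the machine, their size, and the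
final states that show a correct answer. -/
structure Problem where
  Input : Type
  encode : Input → List (List ℕ)
  size : Input → ℕ
  correct : Input → RAMState → Prop

/-- The problem is solved in time `O(t(size))` on a word RAM.  The word size may be any number of bits
that is at least a suitable constant times the logarithm of the magnitude of the input. -/
def Problem.SolvableIn (P : Problem) (t : ℕ → ℝ) : Prop :=
  ∃ (p : Program) (k : ℕ) (C : ℝ), 0 < k ∧
    ∀ (x : P.Input) (W : ℕ), k * (Nat.log2 (magnitude (P.encode x)) + 1) ≤ W →
      ∃ (T : ℕ) (s : RAMState), Exec W p (initState (P.encode x)) T s ∧ P.correct x s ∧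
        (T : ℝ) ≤ C * t (P.size x)

/-! ### Tree edit distance as a computational problem -/

/-- Instances of tree edit distance over the alphabet `Fin k`, with costs in `ℕ ∪ {∞}`.  In the unrooted
problem, each of the two unrooted trees is presented by one of its rootings. -/
structure TEDInstance where
  k : ℕ
  S : RTree (Fin k)
  T : RTree (Fin k)
  del : Fin k → ℕ∞
  mtch : Fin k → Fin k → ℕ∞
  mtch_symm : ∀ a b, mtch a b = mtch b a

namespace TEDInstance

def costs (I : TEDInstance) : Costs (Fin I.k) where
  del a := (I.del a : ℝ≥0∞)
  mtch a b := (I.mtch a b : ℝ≥0∞)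
  mtch_symm a b := by rw [I.mtch_symm]

/-- The size of the larger tree. -/
def size (I : TEDInstance) : ℕ := max I.S.nodes I.T.nodes

end TEDInstance

/-- The code of a cost as a word: `0` for `∞`, and `n + 1` for `n`. -/
def costCode (x : ℕ∞) : ℕ := if x = ⊤ then 0 else x.toNat + 1

/-- The code of a rooted tree: in postorder, for every edge its label and the number of edges
below it. -/
def treeCode {k : ℕ} : RTree (Fin k) → List ℕ
  | leaf => []
  | cons a s r => treeCode s ++ [(a : ℕ), s.edges] ++ treeCode r

/-- The code of an instance consists of four arrays: the two trees, the contraction costs, and the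
lower triangle of the symmetric matrix of relabelling costs, row by row. -/
def TEDInstance.encode (I : TEDInstance) : List (List ℕ) :=
  [treeCode I.S, treeCode I.T, List.ofFn fun a => costCode (I.del a),
    (List.finRange I.k).flatMap fun a : Fin I.k =>
      List.ofFn fun b : Fin ((a : ℕ) + 1) => costCode (I.mtch a (Fin.castLE a.isLt b))]

/-- The rooted and the unrooted variant of the problem. -/
inductive Variant
  | rooted
  | unrooted

noncomputable def TEDInstance.dist (I : TEDInstance) : Variant → ℝ≥0∞
  | .rooted => rootedDist I.costs I.S I.T
  | .unrooted => unrootedDist I.costs (unroot I.S) (unroot I.T)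

/-- Tree edit distance, on trees with at most `n` nodes (one of them with exactly `n` nodes), with an
alphabet of at most `f n` labels and with all finite costs at most `n ^ d`.  The distance has to be
returned in the register `0`. -/
noncomputable def ted (v : Variant) (f : ℕ → ℕ) (d : ℕ) : Problem where
  Input := {I : TEDInstance // I.k ≤ f I.size ∧
    (∀ a, I.del a = ⊤ ∨ I.del a ≤ (I.size : ℕ∞) ^ d) ∧
    ∀ a b, I.mtch a b = ⊤ ∨ I.mtch a b ≤ (I.size : ℕ∞) ^ d}
  encode I := I.1.encode
  size I := I.1.size
  correct I s := ∃ x : ℕ∞, I.1.dist v = (x : ℝ≥0∞) ∧ s.reg 0 = costCode x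

/-- There is a truly subcubic algorithm for tree edit distance with polynomially bounded costs, on
alphabets of size at most `f n`. -/
def SubcubicTED (v : Variant) (f : ℕ → ℕ) : Prop :=
  ∀ d : ℕ, ∃ ε : ℝ, 0 < ε ∧ (ted v f d).SolvableIn fun n => (n : ℝ) ^ (3 - ε)

/-! ### All pairs shortest paths -/

/-- `IsWalk w i j x`: there is a walk of total weight `x` from `i` to `j` in the directed graph with arc
weights `w`, where `⊤` means that there is no arc. -/
inductive IsWalk {n : ℕ} (w : Fin n → Fin n → WithTop ℤ) : Fin n → Fin n → ℤ → Prop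
  | nil (i : Fin n) : IsWalk w i i 0
  | cons {i j k : Fin n} {x y : ℤ} : w i j = (x : WithTop ℤ) → IsWalk w j k y →
      IsWalk w i k (x + y)

/-- `y` is the distance from `i` to `j`. -/
def IsDist {n : ℕ} (w : Fin n → Fin n → WithTop ℤ) (i j : Fin n) (y : WithTop ℤ) : Prop :=
  (∀ x : ℤ, IsWalk w i j x → y ≤ x) ∧ (y = ⊤ ∨ ∃ x : ℤ, IsWalk w i j x ∧ y = x)

/-- The code of an element of `ℤ ∪ {∞}` as a word. -/
def weightCode : WithTop ℤ → ℕ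
  | none => 0
  | some x => if 0 ≤ x then 2 * x.natAbs + 1 else 2 * x.natAbs

/-- Weighted directed graphs without negative cycles. -/
structure WeightedDigraph where
  n : ℕ
  pos : 0 < n
  w : Fin n → Fin n → WithTop ℤ
  noNegCycle : ∀ i x, IsWalk w i i x → 0 ≤ x

/-- All pairs shortest paths with integer weights of absolute value at most `n ^ d`; input and output
are matrices, stored row by row in the array `0`. -/
def apsp (d : ℕ) : Problem where
  Input := {G : WeightedDigraph // ∀ i j (x : ℤ), G.w i j = x → |x| ≤ (G.n : ℤ) ^ d}
  encode G := [(List.finRange G.1.n).flatMap fun i => List.ofFn fun j => weightCode (G.1.w i j)]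
  size G := G.1.n
  correct G s := ∀ i j, ∃ y, IsDist G.1.w i j y ∧ s.mem 0 ((i : ℕ) * G.1.n + j) = weightCode y

/-- There is a truly subcubic algorithm for all pairs shortest paths with polynomially bounded
weights. -/
def SubcubicAPSP : Prop :=
  ∀ d : ℕ, ∃ ε : ℝ, 0 < ε ∧ (apsp d).SolvableIn fun n => (n : ℝ) ^ (3 - ε)

/-! ### Maximum weight `k`-clique -/

/-- Edge-weighted undirected graphs; `none` means that there is no edge. -/
structure WeightedGraph where
  n : ℕ
  pos : 0 < n
  w : Fin n → Fin n → Option ℕ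
  symm : ∀ i j, w i j = w j i

/-- The weights of the `k`-cliques: a clique weighs as much as all its edges together. -/
def WeightedGraph.cliqueWeights (G : WeightedGraph) (k : ℕ) : Set ℕ :=
  {x | ∃ K : Finset (Fin G.n), K.card = k ∧ (∀ i ∈ K, ∀ j ∈ K, i ≠ j → G.w i j ≠ none) ∧
    x = ∑ i ∈ K, ∑ j ∈ K with i < j, (G.w i j).getD 0}

/-- Max-Weight `k`-Clique (for a fixed `k`) with weights at most `n ^ (d * k)`.  The matrix of the
weights is stored row by row in the array `0`, with codes `0` for `none` and `x + 1` for `x`; the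
maximum has to be returned in the register `0`, with the same code. -/
def maxWeightClique (d k : ℕ) : Problem where
  Input := {G : WeightedGraph // ∀ i j x, G.w i j = some x → x ≤ G.n ^ (d * k)}
  encode G := [(List.finRange G.1.n).flatMap fun i =>
    List.ofFn fun j => ((G.1.w i j).map Nat.succ).getD 0]
  size G := G.1.n
  correct G s := (G.1.cliqueWeights k = ∅ ∧ s.reg 0 = 0) ∨
    ∃ x, IsGreatest (G.1.cliqueWeights k) x ∧ s.reg 0 = x + 1

/-- For some `ε > 0` and all sufficiently large `k`, there is an algorithm for Max-Weight `k`-Clique that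
runs in time `O(n ^ (k (1 - ε)))`. -/
def FastMaxWeightClique : Prop :=
  ∀ d : ℕ, ∃ ε : ℝ, 0 < ε ∧ ∃ k₀ : ℕ, ∀ k ≥ k₀,
    (maxWeightClique d k).SolvableIn fun n => (n : ℝ) ^ ((k : ℝ) * (1 - ε))

/-- The conditional lower bound from all pairs shortest paths, for one of the two variants of tree edit
distance and alphabets of size at most `f n`. -/
def APSPHard (v : Variant) (f : ℕ → ℕ) : Prop := SubcubicTED v f → SubcubicAPSP

/-- The conditional lower bound from Max-Weight `k`-Clique, for one of the two variants of tree edit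
distance and alphabets of size at most `f n`. -/
def CliqueHard (v : Variant) (f : ℕ → ℕ) : Prop := SubcubicTED v f → FastMaxWeightClique

end TreeEdit

open TreeEdit

/-! Reduction. As `$` cannot be contracted and matches only `$`, a solution of finite cost keeps
both `$`-edges and matches them with each other. An edge together with the two rooted trees at its
ends (a dart, up to reversal) does not depend on the rooting (`dartSet_eq_of_unroot_eq`), and
contraction respects cutting at a kept edge (`exists_darts_of_mem_contract`). The `$`-edge is
pendant, so one of its end trees is trivial and the other one is the original rooted tree. Cutting
at the matched `$`-edges therefore yields a rooted solution of the same cost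
(`exists_rooted_of_unrooted`).

Decomposition algorithms. The hard trees are two complete binary trees hung at one node, and two
caterpillars hung at one node. In every rooting one copy of each survives below an edge, and
whatever the strategy, all pairs of subtrees under edges are met (`Relevant.of_below`). Take a high
node of the binary tree, with halves `X`, `Y` of more than `h` edges, and a node of the
caterpillar's spine with `i` spine nodes after it. Contracting in the first tree only, one side is
eventually used `h` times, which gives `h` pairs. From each of them continue so that a step on that
side contracts in the second tree and a step on the other side in the first one. This keeps alive
what remains of one half of the first tree and one leaf edge of the second, and gives `h * (i + 1)`
pairs that are told apart by counting edges. Summing over the spine yields about `h * m ^ 2 / 2`,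
summing over all nodes of one level about `n * m ^ 2` up to a constant, and about `1 + log (n / m)`
levels are high enough.

Transfer. The gadget is cheap on a word RAM: all four arrays of the code grow only at their ends,
and the code `0` of `∞` is what untouched memory contains. So the input is converted in 19 steps
(`TEDInstance.exec_addGadgetProgram`), and time bounds carry over. -/

namespace TreeEdit

/-! ### Rooted plane trees and their darts -/

namespace RTree

variable {α β γ : Type*}

@[simp] theorem leaf_append (t : RTree α) : leaf.append t = t := rfl

@[simp] theorem cons_append (a : α) (s r t : RTree α) :
    (cons a s r).append t = cons a s (r.append t) := rfl

@[simp] theorem append_leaf (t : RTree α) : t.append leaf = t := by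
  induction t with
  | leaf => rfl
  | cons a s r _ ih => simp [ih]

theorem append_assoc (s t u : RTree α) : (s.append t).append u = s.append (t.append u) := by
  induction s with
  | leaf => rfl
  | cons a s r _ ih => simp [ih]

@[simp] theorem map_leaf (f : α → β) : (leaf : RTree α).map f = leaf := rfl

@[simp] theorem map_cons (f : α → β) (a : α) (s r : RTree α) :
    (cons a s r).map f = cons (f a) (s.map f) (r.map f) := rfl

@[simp] theorem map_append (f : α → β) (s t : RTree α) :
    (s.append t).map f = (s.map f).append (t.map f) := by
  induction s with
  | leaf => rfl
  | cons a s r _ ih => simp [ih]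

theorem map_map (f : α → β) (g : β → γ) (t : RTree α) : (t.map f).map g = t.map (g ∘ f) := by
  induction t with
  | leaf => rfl
  | cons a s r ih₁ ih₂ => simp [ih₁, ih₂]

@[simp] theorem map_id' (t : RTree α) : t.map id = t := by
  induction t with
  | leaf => rfl
  | cons a s r ih₁ ih₂ => simp [ih₁, ih₂]

@[simp] theorem labels_leaf : (leaf : RTree α).labels = [] := rfl

@[simp] theorem labels_cons (a : α) (s r : RTree α) :
    (cons a s r).labels = a :: (s.labels ++ r.labels) := rfl

@[simp] theorem labels_append (s t : RTree α) : (s.append t).labels = s.labels ++ t.labels := by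
  induction s with
  | leaf => rfl
  | cons a s r _ ih => simp [ih]

@[simp] theorem labels_map (f : α → β) (t : RTree α) : (t.map f).labels = t.labels.map f := by
  induction t with
  | leaf => rfl
  | cons a s r ih₁ ih₂ => simp [ih₁, ih₂]

@[simp] theorem edges_leaf : (leaf : RTree α).edges = 0 := rfl

@[simp] theorem edges_cons (a : α) (s r : RTree α) :
    (cons a s r).edges = s.edges + 1 + r.edges := rfl

@[simp] theorem edges_append (s t : RTree α) : (s.append t).edges = s.edges + t.edges := by
  induction s with
  | leaf => simp
  | cons a s r _ ih => simp [ih]; ring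

@[simp] theorem edges_map (f : α → β) (t : RTree α) : (t.map f).edges = t.edges := by
  induction t with
  | leaf => rfl
  | cons a s r ih₁ ih₂ => simp [ih₁, ih₂]

theorem length_labels (t : RTree α) : t.labels.length = t.edges := by
  induction t with
  | leaf => rfl
  | cons a s r ih₁ ih₂ => simp [ih₁, ih₂]; ring

theorem edges_pos {t : RTree α} : 0 < t.edges ↔ t ≠ leaf := by
  cases t <;> simp

/-- The edges of `t`, regarded as a part of the tree in which the root of `t` carries, after the
edges of `t`, also those of `c`.  Every edge is listed with its label, the tree at its lower end and
the tree at its upper end; both trees start with the edge that follows the given one in the cyclic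
order. -/
def darts : RTree α → RTree α → List (α × RTree α × RTree α)
  | leaf, _ => []
  | cons a s r, c => (a, s, r.append c) ::
      (darts s (cons a (r.append c) leaf) ++ darts r (c.append (cons a s leaf)))

theorem map_fst_darts (t c : RTree α) : (darts t c).map Prod.fst = t.labels := by
  induction t generalizing c with
  | leaf => rfl
  | cons a s r ih₁ ih₂ => simp [darts, ih₁, ih₂]

/-- Around the common root the cyclic order is `p`, `q`, `c`: what follows `p` is `q` and then `c`,
and what follows `q` is `c` and then `p`. -/
theorem mem_darts_append {d : α × RTree α × RTree α} (p q c : RTree α) :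
    d ∈ darts (p.append q) c ↔ d ∈ darts p (q.append c) ∨ d ∈ darts q (c.append p) := by
  induction p generalizing c with
  | leaf => simp [darts]
  | cons a s r _ ih =>
    have h : (c.append (cons a s leaf)).append r = c.append (cons a s r) := by
      rw [append_assoc]; rfl
    simp only [cons_append, darts, List.mem_cons, List.mem_append, ih, append_assoc, h]
    tauto

theorem darts_map (f : α → β) (t c : RTree α) :
    darts (t.map f) (c.map f) = (darts t c).map (Prod.map f (Prod.map (map f) (map f))) := by
  induction t generalizing c with
  | leaf => rfl
  | cons a s r ih₁ ih₂ =>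
    have h₁ := ih₁ (cons a (r.append c) leaf)
    have h₂ := ih₂ (c.append (cons a s leaf))
    simp only [map_cons, map_append, map_leaf] at h₁ h₂
    simp [darts, h₁, h₂]

@[simp] theorem _root_.TreeEdit.contract_append (M N : Marked α) :
    contract (M.append N) = (contract M).append (contract N) := by
  induction M with
  | leaf => rfl
  | cons a s r _ ih => rcases a with ⟨a, _ | _⟩ <;> simp [contract, ih, append_assoc]

/-- Cutting at a kept edge commutes with contracting, since both end trees of that edge are
contracted separately. The context `C` is general because the induction moves the rest of the tree
into it. -/
theorem exists_darts_of_mem_contract (M C : Marked α) {d : α × RTree α × RTree α}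
    (h : d ∈ darts (contract M) (contract C)) :
    ∃ X Y, ((d.1, false), X, Y) ∈ darts M C ∧ d.2.1 = contract X ∧ d.2.2 = contract Y := by
  induction M generalizing C with
  | leaf => simp [contract, darts] at h
  | cons a s r ih₁ ih₂ =>
    rcases a with ⟨a, _ | _⟩
    · simp only [contract, darts, List.mem_cons, List.mem_append] at h
      rcases h with rfl | h | h
      · exact ⟨s, r.append C, by simp [darts], rfl, by simp⟩
      · obtain ⟨X, Y, h, e⟩ := ih₁ (cons (a, false) (r.append C) leaf) (by simpa [contract])
        exact ⟨X, Y, by simp [darts, h], e⟩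
      · obtain ⟨X, Y, h, e⟩ := ih₂ (C.append (cons (a, false) s leaf)) (by simpa [contract])
        exact ⟨X, Y, by simp [darts, h], e⟩
    · simp only [contract, mem_darts_append] at h
      rcases h with h | h
      · obtain ⟨X, Y, h, e⟩ := ih₁ (cons (a, true) (r.append C) leaf) (by simpa [contract])
        exact ⟨X, Y, by simp [darts, h], e⟩
      · obtain ⟨X, Y, h, e⟩ := ih₂ (C.append (cons (a, true) s leaf)) (by simpa [contract])
        exact ⟨X, Y, by simp [darts, h], e⟩

end RTree

open RTree

/-! ### Invariants of rerooting -/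

section Unroot

variable {α β : Type*}

theorem unroot_eq_of_step {s t : RTree α} (h : RerootStep s t) : unroot s = unroot t :=
  Quotient.sound (Relation.EqvGen.rel _ _ h)

/-- The principle behind all invariants of unrooted trees: only the two elementary steps have to be
checked. -/
theorem eqv_of_unroot_eq {R : RTree α → RTree α → Prop} (hR : Equivalence R)
    (hstep : ∀ s t, RerootStep s t → R s t) {s t : RTree α} (h : unroot s = unroot t) : R s t := by
  have h' : Relation.EqvGen RerootStep s t := Quotient.exact h
  induction h' with
  | rel _ _ h₀ => exact hstep _ _ h₀
  | refl => exact hR.refl _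
  | symm _ _ _ ih => exact hR.symm (ih (Quotient.sound (by assumption)))
  | trans _ _ _ _ _ ih₁ ih₂ =>
    exact hR.trans (ih₁ (Quotient.sound (by assumption))) (ih₂ (Quotient.sound (by assumption)))

theorem eq_of_unroot_eq (φ : RTree α → β) (hφ : ∀ s t, RerootStep s t → φ s = φ t)
    {s t : RTree α} (h : unroot s = unroot t) : φ s = φ t :=
  eqv_of_unroot_eq (R := fun s t => φ s = φ t)
    ⟨fun _ => rfl, fun h => h.symm, fun h h' => h.trans h'⟩ hφ h

theorem unroot_cross (a : α) (s r : RTree α) : unroot (cons a s r) = unroot (cons a r s) :=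
  unroot_eq_of_step (.cross a s r)

theorem unroot_map (f : α → β) {s t : RTree α} (h : unroot s = unroot t) :
    unroot (s.map f) = unroot (t.map f) := by
  refine eq_of_unroot_eq (fun t => unroot (t.map f)) ?_ h
  rintro _ _ (⟨a, s, r⟩ | ⟨a, s, r⟩)
  · simpa using unroot_eq_of_step (.rotate (f a) (s.map f) (r.map f))
  · simpa using unroot_eq_of_step (.cross (f a) (s.map f) (r.map f))

theorem labels_perm_of_unroot_eq {s t : RTree α} (h : unroot s = unroot t) :
    s.labels.Perm t.labels := by
  refine eqv_of_unroot_eq (R := fun s t => s.labels.Perm t.labels)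
    ⟨fun _ => .refl _, fun h => h.symm, fun h h' => h.trans h'⟩ ?_ h
  rintro _ _ (⟨a, s, r⟩ | ⟨a, s, r⟩)
  · simp only [labels_cons, labels_append, labels_leaf, List.append_nil]
    rw [← List.cons_append]
    exact List.perm_append_comm
  · exact (List.perm_append_comm).cons a

/-- The edges of a plane tree with the trees at both ends, in any order. -/
def dartSet (t : RTree α) : Set (α × RTree α × RTree α) :=
  {d | d ∈ darts t leaf ∨ (d.1, d.2.2, d.2.1) ∈ darts t leaf}

/-- Rotating permutes the list of darts. Crossing the leftmost edge reverses the dart of that edge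
and permutes the others. -/
theorem dartSet_eq_of_unroot_eq {s t : RTree α} (h : unroot s = unroot t) :
    dartSet s = dartSet t := by
  refine eq_of_unroot_eq dartSet ?_ h
  rintro _ _ (⟨a, s, r⟩ | ⟨a, s, r⟩)
  · have : ∀ d, d ∈ darts (r.append (cons a s leaf)) leaf ↔ d ∈ darts (cons a s r) leaf := by
      intro d
      rw [show cons a s r = (cons a s leaf).append r from rfl, mem_darts_append, mem_darts_append]
      simp [or_comm]
    ext d
    simp only [dartSet, Set.mem_ofPred_eq, this]
  · ext ⟨b, x, y⟩
    simp only [dartSet, darts, append_leaf, leaf_append, List.mem_cons, List.mem_append,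
      Set.mem_ofPred_eq, Prod.mk.injEq]
    tauto

/-- A tree can be rerooted at any of its edges: rotate until the branch with the edge is leftmost,
cross, and repeat. -/
theorem unroot_eq_of_mem_darts {t c : RTree α} {a : α} {x y : RTree α}
    (h : (a, x, y) ∈ darts t c) : unroot (t.append c) = unroot (cons a x y) := by
  induction t generalizing c with
  | leaf => simp [darts] at h
  | cons b s r ih₁ ih₂ =>
    simp only [darts, List.mem_cons, List.mem_append, Prod.mk.injEq] at h
    rcases h with ⟨rfl, rfl, rfl⟩ | h | h
    · rfl
    · rw [← ih₁ h, cons_append, unroot_cross]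
      exact unroot_eq_of_step (.rotate _ _ _)
    · rw [← ih₂ h, cons_append, ← append_assoc]
      exact unroot_eq_of_step (.rotate _ _ _)

end Unroot


/-! ### Relabelling of trees, markings and costs -/

section Relabelling

variable {α β : Type*}

/-- Costs of labels that are read through a function. -/
def Costs.comap (f : β → α) (c : Costs α) : Costs β where
  del b := c.del (f b)
  mtch b b' := c.mtch (f b) (f b')
  mtch_symm _ _ := c.mtch_symm _ _

@[simp] theorem contracted_append (M N : Marked α) :
    contracted (M.append N) = contracted M ++ contracted N := by
  induction M with
  | leaf => rfl
  | cons a s r _ ih => rcases a with ⟨a, _ | _⟩ <;> simp [contracted, ih]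

theorem contract_map (f : β → α) (M : Marked β) :
    contract (M.map (Prod.map f id)) = (contract M).map f := by
  induction M with
  | leaf => rfl
  | cons a s r ih₁ ih₂ => rcases a with ⟨a, _ | _⟩ <;> simp [contract, ih₁, ih₂]

theorem contracted_map (f : β → α) (M : Marked β) :
    contracted (M.map (Prod.map f id)) = (contracted M).map f := by
  induction M with
  | leaf => rfl
  | cons a s r ih₁ ih₂ => rcases a with ⟨a, _ | _⟩ <;> simp [contracted, ih₁, ih₂]

theorem pairs_map (f : β → α) (s t : RTree β) :
    pairs (s.map f) (t.map f) = (pairs s t).map (Prod.map f f) := by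
  induction s generalizing t with
  | leaf => rfl
  | cons a s r ih₁ ih₂ => cases t <;> simp [pairs, ih₁, ih₂]

theorem pairs_map_fst_map_snd (Z : RTree (α × α)) :
    pairs (Z.map Prod.fst) (Z.map Prod.snd) = Z.labels := by
  induction Z with
  | leaf => rfl
  | cons a s r ih₁ ih₂ => simp [pairs, ih₁, ih₂]

theorem matched_map (f : β → α) (M N : Marked β) :
    matched (M.map (Prod.map f id)) (N.map (Prod.map f id)) =
      (matched M N).map (Prod.map f f) := by
  simp [matched, contract_map, pairs_map]

theorem editCost_map (f : β → α) (c : Costs α) (M N : Marked β) :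
    editCost c (M.map (Prod.map f id)) (N.map (Prod.map f id)) = editCost (c.comap f) M N := by
  simp only [editCost, contracted_map, matched_map, List.map_map]
  rfl

theorem SameShape.map (f : β → α) {s t : RTree β} (h : SameShape s t) :
    SameShape (s.map f) (t.map f) := by
  simpa only [SameShape, map_map, Function.comp_def] using h

theorem SameShape.of_map {f : β → α} {s t : RTree β} (h : SameShape (s.map f) (t.map f)) :
    SameShape s t := by
  simpa only [SameShape, map_map, Function.comp_def] using h

theorem map_fst_map (f : β → α) (M : Marked β) :
    (M.map (Prod.map f id)).map Prod.fst = (M.map Prod.fst).map f := by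
  simp only [map_map]
  rfl

theorem IsRootedSolution.map (f : β → α) {S T : RTree β} {M N : Marked β}
    (h : IsRootedSolution S T M N) :
    IsRootedSolution (S.map f) (T.map f) (M.map (Prod.map f id)) (N.map (Prod.map f id)) := by
  obtain ⟨rfl, rfl, h⟩ := h
  exact ⟨map_fst_map f M, map_fst_map f N, by simpa only [contract_map] using h.map f⟩

theorem rootedDist_map_le (f : β → α) (c : Costs α) (S T : RTree β) :
    rootedDist c (S.map f) (T.map f) ≤ rootedDist (c.comap f) S T := by
  refine le_iInf fun M => le_iInf fun N => le_iInf fun h => ?_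
  rw [← editCost_map]
  exact iInf_le_of_le _ (iInf_le_of_le _ (iInf_le _ (h.map f)))

theorem unrootedDist_map_le (f : β → α) (c : Costs α) (S T : RTree β) :
    unrootedDist c (unroot (S.map f)) (unroot (T.map f)) ≤
      unrootedDist (c.comap f) (unroot S) (unroot T) := by
  refine le_iInf fun S' => le_iInf fun T' => le_iInf fun hS => le_iInf fun hT => ?_
  refine le_trans ?_ (rootedDist_map_le f c S' T')
  exact iInf_le_of_le _ (iInf_le_of_le _ (iInf_le_of_le (unroot_map f hS)
    (iInf_le _ (unroot_map f hT))))

theorem unrootedDist_map_equiv (e : β ≃ α) (c : Costs α) (S T : RTree β) :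
    unrootedDist c (unroot (S.map e)) (unroot (T.map e)) =
      unrootedDist (c.comap e) (unroot S) (unroot T) := by
  refine le_antisymm (unrootedDist_map_le e c S T) ?_
  have h := unrootedDist_map_le e.symm (c.comap e) (S.map e) (T.map e)
  have hc : (c.comap e).comap e.symm = c := by
    cases c
    simp [Costs.comap]
  simpa only [map_map, Equiv.symm_comp_self, map_id', hc] using h

theorem contracted_perm_of_unroot_eq {M N : Marked α} (h : unroot M = unroot N) :
    (contracted M).Perm (contracted N) := by
  refine eqv_of_unroot_eq (R := fun M N : Marked α => (contracted M).Perm (contracted N))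
    ⟨fun _ => .refl _, fun h => h.symm, fun h h' => h.trans h'⟩ ?_ h
  rintro _ _ (⟨⟨a, _ | _⟩, s, r⟩ | ⟨⟨a, _ | _⟩, s, r⟩)
  · simpa [contracted] using List.perm_append_comm
  · simp only [contracted, contracted_append, List.append_nil]
    rw [← List.cons_append]
    exact List.perm_append_comm
  · exact List.perm_append_comm
  · exact (List.perm_append_comm).cons a

/-- Two trees of the same shape are two labellings of one tree, so a matched pair becomes a single
edge of `Z`, and the darts of `Z` cut both trees at once. -/
theorem SameShape.exists_zip {s t : RTree α} (h : SameShape s t) :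
    ∃ Z : RTree (α × α), Z.map Prod.fst = s ∧ Z.map Prod.snd = t := by
  induction s generalizing t with
  | leaf =>
    cases t
    · exact ⟨leaf, rfl, rfl⟩
    · simp [SameShape] at h
  | cons a s r ih₁ ih₂ =>
    cases t with
    | leaf => simp [SameShape] at h
    | cons b s' r' =>
      simp only [SameShape, map_cons, cons.injEq, true_and] at h
      obtain ⟨Z₁, rfl, rfl⟩ := ih₁ h.1
      obtain ⟨Z₂, rfl, rfl⟩ := ih₂ h.2
      exact ⟨cons (a, b) Z₁ Z₂, rfl, rfl⟩

theorem sameShape_map_fst_map_snd (Z : RTree (α × α)) :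
    SameShape (Z.map Prod.fst) (Z.map Prod.snd) := by
  simp [SameShape, map_map, Function.comp_def]

theorem mem_contracted_or_mem_contract {M : Marked α} {a : α}
    (h : a ∈ (M.map Prod.fst).labels) : a ∈ contracted M ∨ a ∈ (contract M).labels := by
  induction M with
  | leaf => simp at h
  | cons b s r ih₁ ih₂ =>
    rcases b with ⟨b, _ | _⟩ <;>
    · simp only [map_cons, labels_cons, List.mem_cons, List.mem_append] at h
      simp only [contracted, contract, labels_cons, labels_append, List.mem_cons,
        List.mem_append]
      tauto

theorem exists_map_eq {f : β → α} {M : Marked α} {S : RTree β}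
    (h : M.map Prod.fst = S.map f) :
    ∃ N : Marked β, M = N.map (Prod.map f id) ∧ N.map Prod.fst = S := by
  induction M generalizing S with
  | leaf =>
    cases S
    · exact ⟨leaf, rfl, rfl⟩
    · simp at h
  | cons a s r ih₁ ih₂ =>
    cases S with
    | leaf => simp at h
    | cons b s' r' =>
      simp only [map_cons, cons.injEq] at h
      obtain ⟨N₁, rfl, rfl⟩ := ih₁ h.2.1
      obtain ⟨N₂, rfl, rfl⟩ := ih₂ h.2.2
      exact ⟨cons (b, a.2) N₁ N₂, by simp [← h.1], rfl⟩

theorem eq_leaf_of_map_eq_leaf {f : β → α} {t : RTree β} (h : t.map f = leaf) : t = leaf := by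
  cases t
  · rfl
  · simp at h

theorem map_le_sum_of_mem {γ : Type*} {l : List γ} {x : γ} (h : x ∈ l) (f : γ → ℝ≥0∞) :
    f x ≤ (l.map f).sum :=
  List.le_sum_of_mem (List.mem_map_of_mem h)

end Relabelling

/-! ### The reduction from rooted to unrooted trees -/

section Gadget

variable {α : Type*}

theorem contract_markedGadget (M : Marked α) : contract (markedGadget M) = gadget (contract M) := by
  simp [markedGadget, contract, gadget, contract_map]

theorem contracted_markedGadget (M : Marked α) :
    contracted (markedGadget M) = (contracted M).map some := by
  simp [markedGadget, contracted, contracted_map]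

theorem matched_markedGadget (M N : Marked α) :
    matched (markedGadget M) (markedGadget N) =
      (none, none) :: (matched M N).map (Prod.map some some) := by
  simp [matched, contract_markedGadget, gadget, pairs, pairs_map]

theorem editCost_markedGadget (c : Costs α) (M N : Marked α) :
    editCost (gadgetCosts c) (markedGadget M) (markedGadget N) = editCost c M N := by
  simp only [editCost, contracted_markedGadget, matched_markedGadget, List.map_map, List.map_cons,
    List.sum_cons]
  simp [gadgetCosts, Function.comp_def]

theorem editCost_eq_of_perm (c : Costs α) {M N M' N' : Marked α}
    (hM : (contracted M).Perm (contracted M')) (hN : (contracted N).Perm (contracted N'))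
    (h : (matched M N).Perm (matched M' N')) : editCost c M N = editCost c M' N' := by
  rw [editCost, editCost, (hM.map _).sum_eq, (hN.map _).sum_eq, (h.map _).sum_eq]

theorem IsRootedSolution.markedGadget {S T : RTree α} {M N : Marked α}
    (h : IsRootedSolution S T M N) :
    IsRootedSolution (gadget S) (gadget T) (markedGadget M) (markedGadget N) := by
  obtain ⟨rfl, rfl, h⟩ := h
  refine ⟨?_, ?_, ?_⟩
  · simp [TreeEdit.markedGadget, gadget, map_fst_map]
  · simp [TreeEdit.markedGadget, gadget, map_fst_map]
  · rw [contract_markedGadget, contract_markedGadget]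
    have := h.map (some : α → Option α)
    simp only [SameShape, gadget, map_cons] at this ⊢
    rw [this]

/-- The label `none` occurs only on the new edge, and that edge is pendant. -/
theorem dart_none_gadget {S : RTree α} {x y : RTree (Option α)}
    (h : (none, x, y) ∈ dartSet (gadget S)) :
    (x = S.map some ∧ y = leaf) ∨ (x = leaf ∧ y = S.map some) := by
  have key : ∀ x y : RTree (Option α), (none, x, y) ∈ darts (gadget S) leaf →
      x = S.map some ∧ y = leaf := by
    intro x y h
    simp only [gadget, darts, List.append_nil, List.mem_cons, Prod.mk.injEq, true_and,
      leaf_append] at h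
    refine h.resolve_right fun h => ?_
    have := List.mem_map_of_mem (f := Prod.fst) h
    rw [map_fst_darts, labels_map] at this
    simp at this
  rcases h with h | h
  · exact .inl (key _ _ h)
  · exact .inr (key _ _ h).symm

/-- Rerooting the marked tree at its kept `$`-edge shows a gadget, because the underlying dart is
that of `gadget S` in one of the two directions. -/
theorem exists_markedGadget {S : RTree α} {M' X Y : Marked (Option α)}
    (hM : unroot (M'.map Prod.fst) = unroot (gadget S))
    (h : ((none, false), X, Y) ∈ darts M' leaf) :
    ∃ M : Marked α, M.map Prod.fst = S ∧ unroot M' = unroot (markedGadget M) ∧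
      ((X = M.map (Prod.map some id) ∧ Y = leaf) ∨
        (X = leaf ∧ Y = M.map (Prod.map some id))) := by
  have hr : unroot M' = unroot (cons (none, false) X Y) := by
    simpa using unroot_eq_of_mem_darts h
  have hd : (none, X.map Prod.fst, Y.map Prod.fst) ∈ dartSet (gadget S) := by
    rw [← dartSet_eq_of_unroot_eq hM]
    left
    have := darts_map (Prod.fst : Option α × Bool → Option α) M' leaf
    rw [map_leaf] at this
    rw [this]
    exact List.mem_map_of_mem (f := Prod.map Prod.fst (Prod.map (RTree.map Prod.fst)
      (RTree.map Prod.fst))) h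
  rcases dart_none_gadget hd with ⟨h₁, h₂⟩ | ⟨h₁, h₂⟩
  · obtain ⟨M, rfl, hS⟩ := exists_map_eq h₁
    obtain rfl := eq_leaf_of_map_eq_leaf h₂
    exact ⟨M, hS, hr, .inl ⟨rfl, rfl⟩⟩
  · obtain ⟨M, rfl, hS⟩ := exists_map_eq h₂
    obtain rfl := eq_leaf_of_map_eq_leaf h₁
    exact ⟨M, hS, hr.trans (unroot_cross _ _ _), .inr ⟨rfl, rfl⟩⟩

/-- The `$`-edge is present in every rooting, and contracting it would cost `⊤`. -/
theorem none_mem_contract {c : Costs α} {S : RTree α} {M : Marked (Option α)}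
    (hM : unroot (M.map Prod.fst) = unroot (gadget S))
    (h : ((contracted M).map (gadgetCosts c).del).sum ≠ ⊤) : none ∈ (contract M).labels := by
  refine (mem_contracted_or_mem_contract (M := M) ?_).resolve_left fun hn => ?_
  · exact (labels_perm_of_unroot_eq hM).mem_iff.2 (by simp [gadget])
  · exact h (top_le_iff.1 (map_le_sum_of_mem hn (gadgetCosts c).del))

theorem exists_rooted_of_unrooted {c : Costs α} {S T : RTree α} {M' N' : Marked (Option α)}
    (h : IsUnrootedSolution (unroot (gadget S)) (unroot (gadget T)) M' N')
    (hc : editCost (gadgetCosts c) M' N' ≠ ⊤) :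
    (none, none) ∈ matched M' N' ∧
    ∃ M N : Marked α,
      unroot M' = unroot (markedGadget M) ∧ unroot N' = unroot (markedGadget N) ∧
      (matched M' N').Perm ((none, none) :: (matched M N).map (Prod.map some some)) ∧
      IsRootedSolution S T M N ∧ editCost c M N = editCost (gadgetCosts c) M' N' := by
  obtain ⟨S', T', hS, hT, rfl, rfl, hsh⟩ := h
  obtain ⟨Z, hZ₁, hZ₂⟩ := hsh.exists_zip
  have hZ : matched M' N' = Z.labels := by rw [matched, ← hZ₁, ← hZ₂, pairs_map_fst_map_snd]
  have hcs := hc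
  simp only [editCost, ENNReal.add_ne_top, hZ] at hcs
  have hmem : (none, none) ∈ Z.labels := by
    have hn := none_mem_contract hS hcs.1.1
    rw [← hZ₁, labels_map, List.mem_map] at hn
    -- The partner of the kept `$`-edge is either `$` or an old label, and the latter match would
    -- cost `⊤`.
    obtain ⟨⟨_, _ | b⟩, hp, rfl⟩ := hn
    · exact hp
    · exact absurd (top_le_iff.1 (map_le_sum_of_mem hp
        fun p => (gadgetCosts c).mtch p.1 p.2)) hcs.2
  refine ⟨hZ ▸ hmem, ?_⟩
  rw [← map_fst_darts Z leaf, List.mem_map] at hmem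
  obtain ⟨⟨_, X, Y⟩, hd, rfl⟩ := hmem
  have hperm := labels_perm_of_unroot_eq (unroot_eq_of_mem_darts hd)
  rw [append_leaf, labels_cons] at hperm
  have hdM : (none, X.map Prod.fst, Y.map Prod.fst) ∈ darts (contract M') (contract leaf) := by
    rw [← hZ₁, show (contract leaf : RTree (Option α)) = (leaf : RTree _).map Prod.fst from rfl,
      darts_map]
    exact List.mem_map_of_mem (f := Prod.map Prod.fst (Prod.map (RTree.map Prod.fst)
      (RTree.map Prod.fst))) hd
  have hdN : (none, X.map Prod.snd, Y.map Prod.snd) ∈ darts (contract N') (contract leaf) := by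
    rw [← hZ₂, show (contract leaf : RTree (Option α)) = (leaf : RTree _).map Prod.snd from rfl,
      darts_map]
    exact List.mem_map_of_mem (f := Prod.map Prod.snd (Prod.map (RTree.map Prod.snd)
      (RTree.map Prod.snd))) hd
  obtain ⟨XM, YM, hM, hXM, hYM⟩ := exists_darts_of_mem_contract _ _ hdM
  obtain ⟨XN, YN, hN, hXN, hYN⟩ := exists_darts_of_mem_contract _ _ hdN
  simp only at hXM hYM hXN hYN
  obtain ⟨M, rfl, hMr, hM⟩ := exists_markedGadget hS hM
  obtain ⟨N, rfl, hNr, hN⟩ := exists_markedGadget hT hN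
  have key : SameShape (contract M) (contract N) ∧
      (X.labels ++ Y.labels) = (matched M N).map (Prod.map some some) := by
    rw [← pairs_map_fst_map_snd X, ← pairs_map_fst_map_snd Y, matched, ← pairs_map]
    have hX := sameShape_map_fst_map_snd X
    have hY := sameShape_map_fst_map_snd Y
    rw [hXM, hXN] at hX ⊢
    rw [hYM, hYN] at hY ⊢
    -- If the `$`-edges are matched in opposite directions, each of the original trees faces a
    -- trivial tree. Then both contract to `leaf`, and nothing else is matched.
    rcases hM with ⟨rfl, rfl⟩ | ⟨rfl, rfl⟩ <;> rcases hN with ⟨rfl, rfl⟩ | ⟨rfl, rfl⟩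
    · rw [contract_map, contract_map] at *
      exact ⟨hX.of_map, by simp [contract, pairs]⟩
    · rw [contract_map] at *
      have h₁ := eq_leaf_of_map_eq_leaf (eq_leaf_of_map_eq_leaf (f := fun _ => ()) hX)
      have h₂ := eq_leaf_of_map_eq_leaf (eq_leaf_of_map_eq_leaf (f := fun _ => ()) hY.symm)
      simp [h₁, h₂, SameShape, pairs, contract]
    · rw [contract_map] at *
      have h₁ := eq_leaf_of_map_eq_leaf (eq_leaf_of_map_eq_leaf (f := fun _ => ()) hX.symm)
      have h₂ := eq_leaf_of_map_eq_leaf (eq_leaf_of_map_eq_leaf (f := fun _ => ()) hY)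
      simp [h₁, h₂, SameShape, pairs, contract]
    · rw [contract_map, contract_map] at *
      exact ⟨hY.of_map, by simp [contract, pairs]⟩
  rw [key.2, ← hZ] at hperm
  refine ⟨M, N, hMr, hNr, hperm, ⟨rfl, rfl, key.1⟩, ?_⟩
  rw [← editCost_markedGadget]
  refine editCost_eq_of_perm _ (contracted_perm_of_unroot_eq hMr).symm
    (contracted_perm_of_unroot_eq hNr).symm ?_
  rw [matched_markedGadget]
  exact hperm.symm

theorem unrootedDist_le_editCost (c : Costs α) {U V : UTree α} {M N : Marked α}
    (h : IsUnrootedSolution U V M N) : unrootedDist c U V ≤ editCost c M N := by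
  obtain ⟨S, T, hS, hT, h⟩ := h
  exact iInf_le_of_le S (iInf_le_of_le T (iInf_le_of_le hS (iInf_le_of_le hT
    (iInf_le_of_le M (iInf_le_of_le N (iInf_le _ h))))))

theorem IsRootedSolution.isUnrootedSolution {S T : RTree α} {M N : Marked α}
    (h : IsRootedSolution S T M N) : IsUnrootedSolution (unroot S) (unroot T) M N :=
  ⟨S, T, rfl, rfl, h⟩

theorem unrootedDist_gadget (c : Costs α) (S T : RTree α) :
    unrootedDist (gadgetCosts c) (unroot (gadget S)) (unroot (gadget T)) = rootedDist c S T := by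
  apply le_antisymm
  · refine le_iInf fun M => le_iInf fun N => le_iInf fun h => ?_
    rw [← editCost_markedGadget]
    exact unrootedDist_le_editCost _ h.markedGadget.isUnrootedSolution
  · refine le_iInf fun S' => le_iInf fun T' => le_iInf fun hS => le_iInf fun hT =>
      le_iInf fun M' => le_iInf fun N' => le_iInf fun h => ?_
    by_cases hc : editCost (gadgetCosts c) M' N' = ⊤
    · simp [hc]
    obtain ⟨-, M, N, -, -, -, hr, he⟩ := exists_rooted_of_unrooted ⟨S', T', hS, hT, h⟩ hc
    rw [← he]
    exact iInf_le_of_le M (iInf_le_of_le N (iInf_le _ hr))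

theorem optimal_unrooted_gadget (c : Costs α) (S T : RTree α) (M' N' : Marked (Option α))
    (h : IsOptimalUnrooted (gadgetCosts c) (unroot (gadget S)) (unroot (gadget T)) M' N')
    (hc : editCost (gadgetCosts c) M' N' ≠ ⊤) :
    (none, none) ∈ matched M' N' ∧
    ∃ M N : Marked α,
      unroot M' = unroot (markedGadget M) ∧ unroot N' = unroot (markedGadget N) ∧
      (matched M' N').Perm ((none, none) :: (matched M N).map (Prod.map some some)) ∧
      IsOptimalRooted c S T M N ∧ editCost c M N = editCost (gadgetCosts c) M' N' := by
  obtain ⟨hn, M, N, h₁, h₂, h₃, h₄, h₅⟩ := exists_rooted_of_unrooted h.1 hc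
  refine ⟨hn, M, N, h₁, h₂, h₃, ⟨h₄, fun M₀ N₀ h₀ => ?_⟩, h₅⟩
  rw [h₅, ← editCost_markedGadget c M₀ N₀]
  exact h.2 _ _ h₀.markedGadget.isUnrootedSolution

end Gadget


/-! ### Left-right symmetry, and subtrees under edges -/

section Sides

variable {α : Type*}

/-- Gluing two rooted trees at their roots, the first one on the given side of the second one. -/
def glue : Side → RTree α → RTree α → RTree α
  | .left, x, y => x.append y
  | .right, x, y => y.append x

/-- The opposite side. -/
def Side.other : Side → Side
  | .left => .right
  | .right => .left

theorem Side.eq_or_eq_other (d d' : Side) : d' = d ∨ d' = d.other := by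
  cases d <;> cases d' <;> simp [Side.other]

theorem glue_other (d : Side) (x y : RTree α) : glue d.other x y = glue d y x := by
  cases d <;> rfl

theorem glue_assoc (d : Side) (x y z : RTree α) :
    glue d (glue d x y) z = glue d x (glue d y z) := by
  cases d <;> simp [glue, append_assoc]

@[simp] theorem edges_glue (d : Side) (x y : RTree α) :
    (glue d x y).edges = x.edges + y.edges := by
  cases d <;> simp [glue, add_comm]

theorem labels_glue_perm (d : Side) (x y : RTree α) :
    (glue d x y).labels.Perm (x.labels ++ y.labels) := by
  cases d <;> simp only [glue, labels_append]
  · exact .refl _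
  · exact List.perm_append_comm

theorem mem_labels_glue {d : Side} {x y : RTree α} {a : α} :
    a ∈ (glue d x y).labels ↔ a ∈ x.labels ∨ a ∈ y.labels := by
  rw [(labels_glue_perm d x y).mem_iff, List.mem_append]

theorem glue_ne_leaf_left {d : Side} {x : RTree α} (hx : x ≠ leaf) (y : RTree α) :
    glue d x y ≠ leaf := by
  rw [← edges_pos] at hx ⊢
  rw [edges_glue]
  omega

theorem glue_ne_leaf_right {d : Side} (x : RTree α) {y : RTree α} (hy : y ≠ leaf) :
    glue d x y ≠ leaf := by
  rw [← edges_pos] at hy ⊢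
  rw [edges_glue]
  omega

theorem underRight_append (a : α) (s r : RTree α) : underRight (r.append (cons a s leaf)) = s := by
  induction r with
  | leaf => rfl
  | cons b t r _ ih =>
    cases r
    · rfl
    · exact ih

theorem restRight_append (a : α) (s r : RTree α) : restRight (r.append (cons a s leaf)) = r := by
  induction r with
  | leaf => rfl
  | cons b t r _ ih =>
    cases r
    · rfl
    · exact congrArg (cons b t) ih

theorem under_glue (d : Side) (a : α) (s r : RTree α) : under d (glue d (cons a s leaf) r) = s := by
  cases d
  · rfl
  · exact underRight_append a s r

theorem rest_glue (d : Side) (a : α) (s r : RTree α) : rest d (glue d (cons a s leaf) r) = r := by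
  cases d
  · rfl
  · exact restRight_append a s r

theorem contractMain_glue_cons (d : Side) (a : α) (s r : RTree α) :
    contractMain d (glue d (cons a s leaf) r) = glue d s r := by
  cases d
  · rfl
  · exact congrArg₂ _ (restRight_append a s r) (underRight_append a s r)

/-- The normal form that shows the main edge of either side, so that later arguments need not
distinguish left from right. -/
theorem exists_eq_glue (d : Side) {t : RTree α} (ht : t ≠ leaf) :
    ∃ a s r, t = glue d (cons a s leaf) r := by
  cases d
  · cases t with
    | leaf => exact absurd rfl ht
    | cons a s r => exact ⟨a, s, r, rfl⟩
  · induction t with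
    | leaf => exact absurd rfl ht
    | cons a s r _ ih =>
      by_cases hr : r = leaf
      · subst hr
        exact ⟨a, s, leaf, rfl⟩
      · obtain ⟨b, s', r', h⟩ := ih hr
        exact ⟨b, s', cons a s r', by rw [h]; rfl⟩

theorem contractMain_glue (d : Side) {x : RTree α} (hx : x ≠ leaf) (y : RTree α) :
    contractMain d (glue d x y) = glue d (contractMain d x) y := by
  obtain ⟨a, s, r, rfl⟩ := exists_eq_glue d hx
  rw [glue_assoc, contractMain_glue_cons, contractMain_glue_cons, glue_assoc]

theorem edges_contractMain (d : Side) {x : RTree α} (hx : x ≠ leaf) :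
    (contractMain d x).edges + 1 = x.edges := by
  obtain ⟨a, s, r, rfl⟩ := exists_eq_glue d hx
  rw [contractMain_glue_cons]
  simp
  ring

theorem labels_contractMain_subset (d : Side) {x : RTree α} (hx : x ≠ leaf) :
    (contractMain d x).labels ⊆ x.labels := by
  obtain ⟨a, s, r, rfl⟩ := exists_eq_glue d hx
  rw [contractMain_glue_cons]
  intro b
  simp only [mem_labels_glue, labels_cons, List.mem_cons, List.mem_append]
  tauto

/-- `Below s t`: the tree `s` is the subtree under some edge of `t`. -/
def Below (s : RTree α) : RTree α → Prop
  | leaf => False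
  | cons _ t r => t = s ∨ Below s t ∨ Below s r

theorem below_append {s : RTree α} (p q : RTree α) :
    Below s (p.append q) ↔ Below s p ∨ Below s q := by
  induction p with
  | leaf => simp [Below]
  | cons a t r _ ih => simp only [cons_append, Below, ih]; tauto

theorem below_glue {d : Side} {s x y : RTree α} :
    Below s (glue d x y) ↔ Below s x ∨ Below s y := by
  cases d <;> simp [glue, below_append, or_comm]

theorem Below.trans {s t u : RTree α} (h : Below s t) (h' : Below t u) : Below s u := by
  induction u with
  | leaf => exact h'
  | cons a x r ih₁ ih₂ =>
    rcases h' with rfl | h' | h'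
    · exact .inr (.inl h)
    · exact .inr (.inl (ih₁ h'))
    · exact .inr (.inr (ih₂ h'))

theorem below_of_mem_darts {a : α} {x y t c : RTree α} (h : (a, x, y) ∈ darts t c) :
    Below x t := by
  induction t generalizing c with
  | leaf => simp [darts] at h
  | cons b s r ih₁ ih₂ =>
    simp only [darts, List.mem_cons, List.mem_append, Prod.mk.injEq] at h
    rcases h with ⟨-, rfl, -⟩ | h | h
    · exact .inl rfl
    · exact .inr (.inl (ih₁ h))
    · exact .inr (.inr (ih₂ h))

/-- A subtree that hangs twice at some node is below an edge in every rooting. -/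
theorem exists_below_of_unroot_eq {P S : RTree α} {c : RTree Unit}
    (hS : S.map (fun _ => ()) = cons () c (cons () c leaf)) (hn : S.labels.Nodup)
    (h : unroot P = unroot S) :
    ∃ F, F.map (fun _ => ()) = c ∧ F.labels.Nodup ∧ Below F P := by
  rcases S with _ | ⟨a, F₁, _ | ⟨b, F₂, _ | _⟩⟩ <;> simp at hS
  obtain ⟨h₁, h₂⟩ := hS
  simp only [labels_cons, labels_leaf, List.append_nil, List.nodup_cons, List.nodup_append] at hn
  have hd : (a, F₁, cons b F₂ leaf) ∈ dartSet P := by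
    rw [dartSet_eq_of_unroot_eq h]
    exact .inl (by simp [darts])
  -- If the root of `P` lies beyond `a`, then `F₁` hangs below an edge. If it lies within `F₁`, then
  -- the dart is reversed and the other copy `F₂` is intact below `b`.
  rcases hd with hd | hd
  · exact ⟨F₁, h₁, hn.2.1, below_of_mem_darts hd⟩
  · exact ⟨F₂, h₂, hn.2.2.1.2, Below.trans (t := cons b F₂ leaf) (Or.inl rfl) (below_of_mem_darts hd)⟩

end Sides

/-! ### Subproblems that no strategy can avoid -/

section Relevant

variable {α : Type*} {σ : RTree α → RTree α → Side} {P Q : RTree α}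

/-- If contracting one of the two main edges keeps the wanted subtree below an edge, do so; the
total number of edges drops. Otherwise `s` and `t` hang exactly under the two main edges, and the
recursion for matching these edges meets `(s, t)`. -/
theorem Relevant.of_below {F G s t : RTree α} (h : Relevant σ P Q F G) (hs : Below s F)
    (ht : Below t G) : Relevant σ P Q s t := by
  induction hN : F.edges + G.edges using Nat.strong_induction_on generalizing F G with
  | _ N ih =>
    have hF : F ≠ leaf := by rintro rfl; exact hs
    have hG : G ≠ leaf := by rintro rfl; exact ht
    have h₁ := h.contractFst hF hG
    have h₂ := h.contractSnd hF hG
    have h₃ := h.matchUnder hF hG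
    generalize σ F G = d at h₁ h₂ h₃
    obtain ⟨a, x, r, rfl⟩ := exists_eq_glue d hF
    obtain ⟨b, y, r', rfl⟩ := exists_eq_glue d hG
    rw [contractMain_glue_cons] at h₁ h₂
    rw [under_glue, under_glue] at h₃
    simp only [edges_glue, edges_cons, edges_leaf] at hN
    have hs' := hs
    have ht' := ht
    simp only [below_glue, Below, or_false] at hs' ht'
    by_cases hx : Below s (glue d x r)
    · exact ih _ (by simp only [edges_glue, edges_cons, edges_leaf]; omega) h₁ hx ht rfl
    by_cases hy : Below t (glue d y r')
    · exact ih _ (by simp only [edges_glue, edges_cons, edges_leaf]; omega) h₂ hs hy rfl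
    rw [below_glue] at hx hy
    obtain rfl : x = s := by tauto
    obtain rfl : y = t := by tauto
    exact h₃

theorem Relevant.labels_subset {F G : RTree α} (h : Relevant σ P Q F G) :
    (F.labels ⊆ P.labels ∧ F.edges ≤ P.edges) ∧ G.labels ⊆ Q.labels ∧ G.edges ≤ Q.edges := by
  have hc : ∀ (d : Side) (t u : RTree α), t ≠ leaf → t.labels ⊆ u.labels ∧ t.edges ≤ u.edges →
      ((contractMain d t).labels ⊆ u.labels ∧ (contractMain d t).edges ≤ u.edges) ∧
      ((under d t).labels ⊆ u.labels ∧ (under d t).edges ≤ u.edges) ∧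
      ((rest d t).labels ⊆ u.labels ∧ (rest d t).edges ≤ u.edges) := by
    intro d t u ht htu
    obtain ⟨a, s, r, rfl⟩ := exists_eq_glue d ht
    have hl : ∀ b, b ∈ s.labels ∨ b ∈ r.labels → b ∈ u.labels := fun b hb => htu.1 <| by
      simp only [mem_labels_glue, labels_cons, List.mem_cons, List.mem_append]
      tauto
    have he := htu.2
    simp only [edges_glue, edges_cons, edges_leaf] at he
    rw [contractMain_glue_cons, under_glue, rest_glue]
    simp only [edges_glue]
    refine ⟨⟨fun b hb => hl b (mem_labels_glue.1 hb), by omega⟩,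
      ⟨fun b hb => hl b (.inl hb), by omega⟩, ⟨fun b hb => hl b (.inr hb), by omega⟩⟩
  induction h with
  | start => simp
  | contractFst _ hF _ ih => exact ⟨(hc _ _ _ hF ih.1).1, ih.2⟩
  | contractSnd _ _ hG ih => exact ⟨ih.1, (hc _ _ _ hG ih.2).1⟩
  | matchUnder _ hF hG ih => exact ⟨(hc _ _ _ hF ih.1).2.1, (hc _ _ _ hG ih.2).2.1⟩
  | matchRest _ hF hG ih => exact ⟨(hc _ _ _ hF ih.1).2.2, (hc _ _ _ hG ih.2).2.2⟩

/-- Contracting edges of the first tree on one side and of the second tree on the other side. -/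
theorem Relevant.exists_contract_opposite {d : Side} {X Z : RTree α} (hX : X ≠ leaf)
    (hZ : Z ≠ leaf) (n : ℕ) {Y H : RTree α} (hrel : Relevant σ P Q (glue d X Y) (glue d H Z))
    (hH : n ≤ H.edges) (hY : n < Y.edges) :
    ∃ Y' H', Relevant σ P Q (glue d X Y') (glue d H' Z) ∧
      Y'.edges + H'.edges + n = Y.edges + H.edges ∧ Y' ≠ leaf ∧
      Y'.labels ⊆ Y.labels ∧ H'.labels ⊆ H.labels := by
  induction n generalizing Y H with
  | zero => exact ⟨Y, H, hrel, rfl, edges_pos.1 hY, by simp, by simp⟩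
  | succ n ih =>
    have hH' : H ≠ leaf := edges_pos.1 (by omega)
    have hY' : Y ≠ leaf := edges_pos.1 (by omega)
    -- On side `d` the second tree is contracted and consumes `H`; on the other side the first one
    -- is contracted and consumes `Y`. So `X` and `Z` are never touched.
    rcases Side.eq_or_eq_other d (σ (glue d X Y) (glue d H Z)) with hd | hd
    · have h := hrel.contractSnd (glue_ne_leaf_left hX Y) (glue_ne_leaf_right H hZ)
      rw [hd, contractMain_glue d hH'] at h
      have he := edges_contractMain d hH'
      obtain ⟨Y₁, H₁, h₁, h₂, h₃, h₄, h₅⟩ := ih h (by omega) (by omega)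
      exact ⟨Y₁, H₁, h₁, by omega, h₃, h₄,
        List.Subset.trans h₅ (labels_contractMain_subset d hH')⟩
    · have h := hrel.contractFst (glue_ne_leaf_left hX Y) (glue_ne_leaf_right H hZ)
      rw [hd, ← glue_other d Y X, contractMain_glue d.other hY', glue_other] at h
      have he := edges_contractMain d.other hY'
      obtain ⟨Y₁, H₁, h₁, h₂, h₃, h₄, h₅⟩ := ih h (by omega) (by omega)
      exact ⟨Y₁, H₁, h₁, by omega, h₃,
        List.Subset.trans h₄ (labels_contractMain_subset d.other hY'), h₅⟩

/-- Contracting edges of the first tree only, until there have been enough contractions on one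
of the sides. -/
theorem Relevant.exists_contract_fst {G : RTree α} (hG : G ≠ leaf) (l r : ℕ) {X Y : RTree α}
    (hl : l ≤ X.edges) (hr : r ≤ Y.edges) (hrel : Relevant σ P Q (X.append Y) G) :
    (∀ j < l, ∃ X' Y' : RTree α, Relevant σ P Q (X'.append Y') G ∧ X'.edges + j = X.edges ∧
      Y.edges ≤ Y'.edges + r ∧ X'.labels ⊆ X.labels ∧ Y'.labels ⊆ Y.labels) ∨
    (∀ j < r, ∃ X' Y' : RTree α, Relevant σ P Q (X'.append Y') G ∧ Y'.edges + j = Y.edges ∧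
      X.edges ≤ X'.edges + l ∧ X'.labels ⊆ X.labels ∧ Y'.labels ⊆ Y.labels) := by
  -- `l` and `r` are the contractions still allowed on the two sides. When one of them reaches zero,
  -- its alternative is vacuous, and the pairs passed on the way supply its earlier values of `j`.
  induction hN : l + r generalizing l r X Y with
  | zero => exact .inl fun j hj => by omega
  | succ N ih =>
    rcases Nat.eq_zero_or_pos l with rfl | hl₀
    · exact .inl fun j hj => by omega
    rcases Nat.eq_zero_or_pos r with rfl | hr₀
    · exact .inr fun j hj => by omega
    have hX : X ≠ leaf := edges_pos.1 (by omega)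
    have hY : Y ≠ leaf := edges_pos.1 (by omega)
    have h := hrel.contractFst (glue_ne_leaf_left (d := .left) hX Y) hG
    cases hd : σ (X.append Y) G with
    | left =>
      rw [hd, show X.append Y = glue .left X Y from rfl, contractMain_glue _ hX] at h
      have he := edges_contractMain .left hX
      have hsub := labels_contractMain_subset .left hX
      rcases ih (l - 1) r (by omega) hr h (by omega) with hc | hc
      · refine .inl fun j hj => ?_
        rcases j with _ | j
        · exact ⟨X, Y, hrel, rfl, by omega, by simp, by simp⟩
        · obtain ⟨X', Y', h₁, h₂, h₃, h₄, h₅⟩ := hc j (by omega)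
          exact ⟨X', Y', h₁, by omega, h₃, List.Subset.trans h₄ hsub, h₅⟩
      · refine .inr fun j hj => ?_
        obtain ⟨X', Y', h₁, h₂, h₃, h₄, h₅⟩ := hc j hj
        exact ⟨X', Y', h₁, h₂, by omega, List.Subset.trans h₄ hsub, h₅⟩
    | right =>
      rw [hd, show X.append Y = glue .right Y X from rfl, contractMain_glue _ hY] at h
      have he := edges_contractMain .right hY
      have hsub := labels_contractMain_subset .right hY
      rcases ih l (r - 1) hl (by omega) h (by omega) with hc | hc
      · refine .inl fun j hj => ?_
        obtain ⟨X', Y', h₁, h₂, h₃, h₄, h₅⟩ := hc j hj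
        exact ⟨X', Y', h₁, h₂, by omega, h₄, List.Subset.trans h₅ hsub⟩
      · refine .inr fun j hj => ?_
        rcases j with _ | j
        · exact ⟨X, Y, hrel, rfl, by omega, by simp, by simp⟩
        · obtain ⟨X', Y', h₁, h₂, h₃, h₄, h₅⟩ := hc j (by omega)
          exact ⟨X', Y', h₁, by omega, h₃, h₄, List.Subset.trans h₅ hsub⟩

end Relevant

/-! ### Counting distinct subproblems -/

section Counting

variable {σ : RTree ℕ → RTree ℕ → Side} {P Q : RTree ℕ}

theorem exists_label {t : RTree ℕ} (ht : t ≠ leaf) : ∃ a, a ∈ t.labels := by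
  cases t with
  | leaf => exact absurd rfl ht
  | cons a s r => exact ⟨a, by simp⟩

/-- The subproblems that are met after contracting first only edges of the first tree, and
then edges of the first tree on one side and of the second tree on the other side. -/
theorem exists_finset_of_side (d : Side) {X Y H Z : RTree ℕ} (hZ : Z ≠ leaf)
    (hdisj : ∀ a ∈ X.labels, a ∉ Y.labels) {h s : ℕ} (hX : h ≤ X.edges)
    (hY : h + s ≤ Y.edges) (hs : s ≤ H.edges + 1)
    (hc : ∀ j < h, ∃ X' Y', Relevant σ P Q (glue d X' Y') (glue d H Z) ∧ X'.edges + j = X.edges ∧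
      Y.edges ≤ Y'.edges + h ∧ X'.labels ⊆ X.labels ∧ Y'.labels ⊆ Y.labels) :
    ∃ D : Finset (RTree ℕ × RTree ℕ), D.card = h * s ∧ ∀ q ∈ D, Relevant σ P Q q.1 q.2 ∧
      (∀ a ∈ q.1.labels, a ∈ X.labels ∨ a ∈ Y.labels) ∧
      (∃ a ∈ q.1.labels, a ∈ X.labels) ∧ (∃ a ∈ q.1.labels, a ∈ Y.labels) ∧
      (∀ a ∈ q.2.labels, a ∈ H.labels ∨ a ∈ Z.labels) ∧ (∀ a ∈ Z.labels, a ∈ q.2.labels) := by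
  classical
  have : Inhabited (RTree ℕ) := ⟨leaf⟩
  choose! X' Y' hrel hXe hYe hXl hYl using hc
  -- The indices can be read off the pair, which makes the map injective: the number of labels from
  -- `X` determines `j`, and then the total number of edges determines `n`.
  have step : ∀ p : ℕ × ℕ, p.1 < h → p.2 < s → ∃ q : RTree ℕ × RTree ℕ,
      (q.1.labels.countP (· ∈ X.labels) + p.1 = X.edges ∧
        q.1.edges + q.2.edges + p.2 = (X' p.1).edges + (Y' p.1).edges + H.edges + Z.edges) ∧
      Relevant σ P Q q.1 q.2 ∧
      (∀ a ∈ q.1.labels, a ∈ X.labels ∨ a ∈ Y.labels) ∧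
      (∃ a ∈ q.1.labels, a ∈ X.labels) ∧ (∃ a ∈ q.1.labels, a ∈ Y.labels) ∧
      (∀ a ∈ q.2.labels, a ∈ H.labels ∨ a ∈ Z.labels) ∧ (∀ a ∈ Z.labels, a ∈ q.2.labels) := by
    rintro ⟨j, n⟩ hj hn
    simp only at hj hn
    have hXj : X' j ≠ leaf := edges_pos.1 (by have := hXe j hj; omega)
    obtain ⟨Y₁, H₁, h₁, h₂, h₃, h₄, h₅⟩ := (hrel j hj).exists_contract_opposite hXj hZ n
      (by omega) (by have := hYe j hj; omega)
    have h₄' := List.Subset.trans h₄ (hYl j hj)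
    refine ⟨(glue d (X' j) Y₁, glue d H₁ Z), ⟨?_, ?_⟩, h₁, ?_, ?_, ?_, ?_, ?_⟩
    · rw [(labels_glue_perm d (X' j) Y₁).countP_eq, List.countP_append,
        List.countP_eq_length.2 (fun a ha => by simpa using hXl j hj ha), List.countP_eq_zero.2, length_labels]
      · simpa using hXe j hj
      · intro a ha
        simpa using fun hX => hdisj a hX (h₄' ha)
    · simp only [edges_glue]
      omega
    · intro a ha
      exact (mem_labels_glue.1 ha).imp (fun h => hXl j hj h) fun h => h₄' h
    · obtain ⟨a, ha⟩ := exists_label hXj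
      exact ⟨a, mem_labels_glue.2 (.inl ha), hXl j hj ha⟩
    · obtain ⟨a, ha⟩ := exists_label h₃
      exact ⟨a, mem_labels_glue.2 (.inr ha), h₄' ha⟩
    · intro a ha
      exact (mem_labels_glue.1 ha).imp (fun h => h₅ h) id
    · intro a ha
      exact mem_labels_glue.2 (.inr ha)
  choose! φ hφ hφ' using step
  refine ⟨(Finset.range h ×ˢ Finset.range s).image φ, ?_, ?_⟩
  · rw [Finset.card_image_of_injOn, Finset.card_product, Finset.card_range, Finset.card_range]
    rintro ⟨j, n⟩ hp ⟨j', n'⟩ hp' he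
    simp only [Finset.coe_product, Set.mem_prod, Finset.coe_range, Set.mem_Iio] at hp hp'
    have e₁ := hφ (j, n) hp.1 hp.2
    have e₂ := hφ (j', n') hp'.1 hp'.2
    simp only at e₁ e₂ he
    rw [he] at e₁
    obtain rfl : j = j' := by omega
    obtain rfl : n = n' := by omega
    rfl
  · intro q hq
    obtain ⟨⟨j, n⟩, hp, rfl⟩ := Finset.mem_image.1 hq
    simp only [Finset.mem_product, Finset.mem_range] at hp
    exact hφ' (j, n) hp.1 hp.2

/-- The caterpillar in which every inner node of the spine has a further child on either side. -/
def caterpillar : ℕ → RTree Unit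
  | 0 => leaf
  | i + 1 => cons () leaf (cons () (caterpillar i) (cons () leaf leaf))

theorem edges_caterpillar (i : ℕ) : (caterpillar i).edges = 3 * i := by
  induction i with
  | zero => rfl
  | succ i ih => simp [caterpillar, ih]; ring

/-- The complete binary tree of a given height. -/
def completeBinary : ℕ → RTree Unit
  | 0 => leaf
  | i + 1 => cons () (completeBinary i) (cons () (completeBinary i) leaf)

theorem edges_completeBinary (i : ℕ) : (completeBinary i).edges + 2 = 2 ^ (i + 1) := by
  induction i with
  | zero => rfl
  | succ i ih =>
    rw [pow_succ, ← ih]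
    simp [completeBinary]
    ring

theorem edges_eq_of_map_eq {t : RTree ℕ} {c : RTree Unit} (h : t.map (fun _ => ()) = c) :
    t.edges = c.edges := by
  rw [← h, edges_map]

/-- Every spine node contributes `h` times the length of its spine. Its pairs retain one of the two
leaf edges `x`, `z` at that node, so they differ from those of all deeper spine nodes. The bound `h
+ m` leaves enough edges for both phases of contractions. -/
theorem exists_finset_caterpillar {X Y : RTree ℕ} (hdisj : ∀ a ∈ X.labels, a ∉ Y.labels)
    {h m : ℕ} (hX : h + m ≤ X.edges) (hY : h + m ≤ Y.edges) {i : ℕ} (hi : i ≤ m)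
    {G : RTree ℕ} (hG : G.map (fun _ => ()) = caterpillar i) (hn : G.labels.Nodup)
    (hrel : ∀ t, t = G ∨ Below t G → Relevant σ P Q (X.append Y) t) :
    ∃ D : Finset (RTree ℕ × RTree ℕ), h * ∑ j ∈ Finset.range (i + 1), j ≤ D.card ∧
      ∀ q ∈ D, Relevant σ P Q q.1 q.2 ∧ (∀ a ∈ q.1.labels, a ∈ X.labels ∨ a ∈ Y.labels) ∧
        (∃ a ∈ q.1.labels, a ∈ X.labels) ∧ (∃ a ∈ q.1.labels, a ∈ Y.labels) ∧
        q.2 ≠ leaf ∧ ∀ a ∈ q.2.labels, a ∈ G.labels := by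
  classical
  induction i generalizing G with
  | zero => exact ⟨∅, by simp, by simp⟩
  | succ i ih =>
    rcases G with _ | ⟨x, _ | _, _ | ⟨y, G', _ | ⟨z, _ | _, _ | _⟩⟩⟩ <;>
      simp [caterpillar] at hG
    have hGe := edges_eq_of_map_eq hG
    rw [edges_caterpillar] at hGe
    obtain ⟨D, hD, hD'⟩ := ih (by omega) hG
      (by
        simp only [labels_cons, labels_leaf, List.nil_append, List.append_nil, List.nodup_cons,
          List.nodup_append] at hn
        exact hn.2.2.1)
      (fun t ht => hrel t (.inr (.inr (.inr (ht.imp Eq.symm .inl)))))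
    have hx : x ∉ G'.labels := fun hx => by simp [hx] at hn
    have hz : z ∉ G'.labels := fun hz => by
      simp only [labels_cons, labels_leaf, List.nil_append, List.append_nil, List.nodup_cons,
        List.nodup_append] at hn
      exact hn.2.2.2.2 z hz z (by simp) rfl
    obtain ⟨E, hE, hE'⟩ : ∃ E : Finset (RTree ℕ × RTree ℕ), E.card = h * (i + 1) ∧
        ∀ q ∈ E, (Relevant σ P Q q.1 q.2 ∧ (∀ a ∈ q.1.labels, a ∈ X.labels ∨ a ∈ Y.labels) ∧
          (∃ a ∈ q.1.labels, a ∈ X.labels) ∧ (∃ a ∈ q.1.labels, a ∈ Y.labels) ∧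
          ∀ a ∈ q.2.labels, a ∈ (cons x leaf (cons y G' (cons z leaf leaf))).labels) ∧
          (x ∈ q.2.labels ∨ z ∈ q.2.labels) := by
      -- The side that first reaches `h` contractions decides which leaf edge is protected: the one
      -- on the opposite side, `z` for left and `x` for right.
      rcases (hrel _ (.inl rfl)).exists_contract_fst (by simp) h h (by omega) (by omega)
        with hc | hc
      · obtain ⟨E, hE, hE'⟩ := exists_finset_of_side (σ := σ) (P := P) (Q := Q) .left
          (X := X) (Y := Y) (H := cons x leaf (cons y G' leaf)) (Z := cons z leaf leaf)
          (h := h) (s := i + 1) (by simp) hdisj (by omega) (by omega) (by simp; omega)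
          (fun j hj => hc j hj)
        refine ⟨E, hE, fun q hq => ?_⟩
        obtain ⟨h₁, h₂, h₃, h₄, h₅, h₆⟩ := hE' q hq
        refine ⟨⟨h₁, h₂, h₃, h₄, fun a ha => ?_⟩, .inr (h₆ z (by simp))⟩
        have := h₅ a ha
        simp at this ⊢
        tauto
      · obtain ⟨E, hE, hE'⟩ := exists_finset_of_side (σ := σ) (P := P) (Q := Q) .right
          (X := Y) (Y := X) (H := cons y G' (cons z leaf leaf)) (Z := cons x leaf leaf)
          (h := h) (s := i + 1) (by simp) (fun a ha ha' => hdisj a ha' ha) (by omega) (by omega)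
          (by simp; omega)
          (fun j hj => by
            obtain ⟨X', Y', h₁, h₂, h₃, h₄, h₅⟩ := hc j hj
            exact ⟨Y', X', h₁, h₂, h₃, h₅, h₄⟩)
        refine ⟨E, hE, fun q hq => ?_⟩
        obtain ⟨h₁, h₂, h₃, h₄, h₅, h₆⟩ := hE' q hq
        refine ⟨⟨h₁, fun a ha => (h₂ a ha).symm, h₄, h₃, fun a ha => ?_⟩, .inl (h₆ x (by simp))⟩
        have := h₅ a ha
        simp at this ⊢
        tauto
    refine ⟨D ∪ E, ?_, ?_⟩
    · rw [Finset.card_union_of_disjoint, Finset.sum_range_succ, mul_add, hE]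
      · exact Nat.add_le_add_right hD _
      · rw [Finset.disjoint_left]
        intro q hq hq'
        exact (hE' q hq').2.elim (fun h => hx ((hD' q hq).2.2.2.2.2 _ h))
          fun h => hz ((hD' q hq).2.2.2.2.2 _ h)
    · intro q hq
      rcases Finset.mem_union.1 hq with hq | hq
      · obtain ⟨h₁, h₂, h₃, h₄, h₅, h₆⟩ := hD' q hq
        refine ⟨h₁, h₂, h₃, h₄, h₅, fun a ha => ?_⟩
        have := h₆ a ha
        simp
        tauto
      · obtain ⟨⟨h₁, h₂, h₃, h₄, h₅⟩, h₆⟩ := hE' q hq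
        refine ⟨h₁, h₂, h₃, h₄, ?_, h₅⟩
        intro h
        simp [h] at h₆

/-- With `h = 2 ^ (q + e)` the root of a tree of height `q + e + 1` contributes `h` times the sum
over the spine, and `m + 1 ≤ 2 ^ q` makes both halves large enough. Its pairs contain labels from
both halves, so they are disjoint from those counted within one half. The count thus doubles and
gains one such term per level; hence the factor `e * 2 ^ (q + e) / 2`. -/
theorem exists_finset_completeBinary {m q : ℕ} (hq : m + 1 ≤ 2 ^ q) {G : RTree ℕ}
    (hG : G.map (fun _ => ()) = caterpillar m) (hGn : G.labels.Nodup) (e : ℕ) {F : RTree ℕ}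
    (hF : F.map (fun _ => ()) = completeBinary (q + e)) (hFn : F.labels.Nodup)
    (hrel : ∀ s t, s = F ∨ Below s F → t = G ∨ Below t G → Relevant σ P Q s t) :
    ∃ D : Finset (RTree ℕ × RTree ℕ),
      e * 2 ^ (q + e) * ∑ j ∈ Finset.range (m + 1), j ≤ 2 * D.card ∧
      ∀ p ∈ D, Relevant σ P Q p.1 p.2 ∧ p.1 ≠ leaf ∧ p.2 ≠ leaf ∧
        ∀ a ∈ p.1.labels, a ∈ F.labels := by
  classical
  induction e generalizing F with
  | zero => exact ⟨∅, by simp, by simp⟩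
  | succ e ih =>
    rcases F with _ | ⟨a, A, _ | ⟨b, B, _ | _⟩⟩ <;>
      simp [completeBinary] at hF
    have hFn' := hFn
    simp only [labels_cons, labels_leaf, List.append_nil, List.nodup_cons, List.nodup_append,
      List.mem_append, List.mem_cons, not_or] at hFn'
    obtain ⟨⟨haA, hab, haB⟩, hA, ⟨hbB, hB⟩, hAB⟩ := hFn'
    obtain ⟨DA, hDA, hDA'⟩ := ih hF.1 hA
      fun s t hs ht => hrel s t (.inr (hs.imp Eq.symm .inl)) ht
    obtain ⟨DB, hDB, hDB'⟩ := ih hF.2 hB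
      fun s t hs ht => hrel s t (.inr (.inr (.inr (hs.imp Eq.symm .inl)))) ht
    have hAe := edges_eq_of_map_eq hF.1
    have hBe := edges_eq_of_map_eq hF.2
    have hce := edges_completeBinary (q + e)
    have hpow : 2 ^ q ≤ 2 ^ (q + e) := Nat.pow_le_pow_right (by norm_num) (by omega)
    rw [pow_succ] at hce
    obtain ⟨E, hE, hE'⟩ := exists_finset_caterpillar (σ := σ) (P := P) (Q := Q)
      (X := cons a A leaf) (Y := cons b B leaf) (h := 2 ^ (q + e)) (m := m) (i := m)
      (by
        intro c hc hc'
        simp only [labels_cons, labels_leaf, List.append_nil, List.mem_cons] at hc hc'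
        rcases hc with rfl | hc
        · exact hc'.elim (fun h => hab h) fun h => haB h
        · rcases hc' with rfl | hc'
          · exact hAB c hc c (.inl rfl) rfl
          · exact hAB c hc c (.inr hc') rfl)
      (by simp; omega) (by simp; omega) le_rfl hG hGn (fun t ht => hrel _ t (.inl rfl) ht)
    have hXY : ∀ p : RTree ℕ × RTree ℕ, (∃ c ∈ p.1.labels, c ∈ (cons b B leaf).labels) →
        ¬ ∀ c ∈ p.1.labels, c ∈ A.labels := by
      rintro p ⟨c, hc, hc'⟩ h
      simp only [labels_cons, labels_leaf, List.append_nil, List.mem_cons] at hc'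
      exact hAB c (h c hc) c hc' rfl
    have hYX : ∀ p : RTree ℕ × RTree ℕ, (∃ c ∈ p.1.labels, c ∈ (cons a A leaf).labels) →
        ¬ ∀ c ∈ p.1.labels, c ∈ B.labels := by
      rintro p ⟨c, hc, hc'⟩ h
      simp only [labels_cons, labels_leaf, List.append_nil, List.mem_cons] at hc'
      rcases hc' with rfl | hc'
      · exact haB (h _ hc)
      · exact hAB c hc' c (.inr (h c hc)) rfl
    refine ⟨DA ∪ DB ∪ E, ?_, ?_⟩
    · rw [Finset.card_union_of_disjoint, Finset.card_union_of_disjoint]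
      · have hpow' : 2 ^ (q + (e + 1)) = 2 * 2 ^ (q + e) := by rw [← Nat.add_assoc, pow_succ']
        rw [hpow']
        nlinarith
      · rw [Finset.disjoint_left]
        intro p hp hp'
        obtain ⟨c, hc⟩ := exists_label (hDA' p hp).2.1
        exact hXY p ⟨c, hc, by simp [(hDB' p hp').2.2.2 c hc]⟩ (hDA' p hp).2.2.2
      · rw [Finset.disjoint_left]
        intro p hp hp'
        rcases Finset.mem_union.1 hp with hp | hp
        · exact hXY p (hE' p hp').2.2.2.1 (hDA' p hp).2.2.2
        · exact hYX p (hE' p hp').2.2.1 (hDB' p hp).2.2.2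
    · intro p hp
      rcases Finset.mem_union.1 hp with hp | hp
      · rcases Finset.mem_union.1 hp with hp | hp
        · obtain ⟨h₁, h₂, h₃, h₄⟩ := hDA' p hp
          exact ⟨h₁, h₂, h₃, fun c hc => by simp [h₄ c hc]⟩
        · obtain ⟨h₁, h₂, h₃, h₄⟩ := hDB' p hp
          exact ⟨h₁, h₂, h₃, fun c hc => by simp [h₄ c hc]⟩
      · obtain ⟨h₁, h₂, ⟨c, hc, -⟩, -, h₃, -⟩ := hE' p hp
        refine ⟨h₁, ?_, h₃, fun c hc => ?_⟩
        · intro h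
          simp [h] at hc
        · have := h₂ c hc
          simp at this ⊢
          tauto

end Counting

/-! ### The lower bound for decomposition algorithms -/

section LowerBound

/-- Labelling the edges in preorder with consecutive numbers. -/
def number : RTree Unit → ℕ → RTree ℕ
  | leaf, _ => leaf
  | cons _ s r, k => cons k (number s (k + 1)) (number r (k + 1 + s.edges))

theorem map_number (t : RTree Unit) (k : ℕ) : (number t k).map (fun _ => ()) = t := by
  induction t generalizing k with
  | leaf => rfl
  | cons a s r ih₁ ih₂ => simp [number, ih₁, ih₂]

theorem labels_number (t : RTree Unit) (k : ℕ) : (number t k).labels = List.range' k t.edges := by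
  induction t generalizing k with
  | leaf => rfl
  | cons a s r ih₁ ih₂ =>
    rw [number, labels_cons, ih₁, ih₂, edges_cons, List.range'_append_1,
      show s.edges + 1 + r.edges = s.edges + r.edges + 1 by ring, List.range'_succ]

theorem nodup_labels_number (t : RTree Unit) (k : ℕ) : (number t k).labels.Nodup := by
  rw [labels_number]
  exact List.nodup_range'

theorem edges_number (t : RTree Unit) (k : ℕ) : (number t k).edges = t.edges :=
  edges_eq_of_map_eq (map_number t k)

theorem finite_labels_subset (l : List ℕ) (N : ℕ) :
    {t : RTree ℕ | t.labels ⊆ l ∧ t.edges ≤ N}.Finite := by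
  induction N with
  | zero =>
    refine (Set.finite_singleton leaf).subset ?_
    rintro (_ | ⟨a, s, r⟩) ⟨-, h⟩
    · rfl
    · simp at h
  | succ N ih =>
    refine ((Set.finite_singleton leaf).union
      ((l.finite_toSet.prod (ih.prod ih)).image fun p => cons p.1 p.2.1 p.2.2)).subset ?_
    rintro (_ | ⟨a, s, r⟩) ⟨h, h'⟩
    · exact .inl rfl
    · simp only [edges_cons] at h'
      simp only [labels_cons, List.cons_subset, List.append_subset] at h
      exact .inr ⟨(a, s, r), ⟨h.1, ⟨h.2.1, by simp only; omega⟩, h.2.2, by simp only; omega⟩, rfl⟩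

/-- Needed because `Set.ncard` is `0` on infinite sets. All subproblems use labels of the inputs and
no more edges than these, even if there are infinitely many strategies. -/
theorem UnrootedDecomposition.finite_subproblems (A : UnrootedDecomposition ℕ) (S T : RTree ℕ) :
    (A.subproblems (unroot S) (unroot T)).Finite := by
  refine ((finite_labels_subset S.labels S.edges).prod
    (finite_labels_subset T.labels T.edges)).subset ?_
  rintro ⟨F, G⟩ ⟨-, -, ⟨P, Q⟩, hp, h⟩
  obtain ⟨h₁, h₂⟩ := A.unroot_rootings _ _ _ hp
  have hP := labels_perm_of_unroot_eq h₁
  have hQ := labels_perm_of_unroot_eq h₂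
  have hP' := hP.length_eq
  have hQ' := hQ.length_eq
  rw [length_labels, length_labels] at hP' hQ'
  obtain ⟨⟨h₃, h₄⟩, h₅, h₆⟩ := h.labels_subset
  exact ⟨⟨List.Subset.trans h₃ hP.subset, h₄.trans hP'.le⟩,
    List.Subset.trans h₅ hQ.subset, h₆.trans hQ'.le⟩

theorem contract_contractAll {α : Type*} (t : RTree α) :
    contract (t.map fun a => (a, true)) = leaf := by
  induction t with
  | leaf => rfl
  | cons a s r ih₁ ih₂ => simp [contract, ih₁, ih₂]

/-- An empty infimum would be `⊤`, whereas with zero costs contracting everything has cost `0`. -/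
theorem UnrootedDecomposition.rootings_nonempty {α : Type*} (A : UnrootedDecomposition α)
    (S T : RTree α) : (A.rootings (unroot S) (unroot T)).Nonempty := by
  rw [Set.nonempty_iff_ne_empty]
  intro h
  have hc := A.correct ⟨fun _ => 0, fun _ _ => 0, fun _ _ => rfl⟩ (unroot S) (unroot T)
  have hs : IsRootedSolution S T (S.map fun a => (a, true)) (T.map fun a => (a, true)) := by
    refine ⟨?_, ?_, ?_⟩
    · rw [map_map]; exact map_id' S
    · rw [map_map]; exact map_id' T
    · rw [contract_contractAll, contract_contractAll]; rfl
  have := unrootedDist_le_editCost ⟨fun _ => 0, fun _ _ => 0, fun _ _ => rfl⟩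
    hs.isUnrootedSolution
  rw [← hc, h] at this
  simp [editCost] at this

theorem UnrootedDecomposition.le_ncard_subproblems (A : UnrootedDecomposition ℕ) {m q e : ℕ}
    (hq : m + 1 ≤ 2 ^ q) {S T : RTree ℕ}
    (hS : S.map (fun _ => ()) =
      cons () (completeBinary (q + e)) (cons () (completeBinary (q + e)) leaf))
    (hT : T.map (fun _ => ()) = cons () (caterpillar m) (cons () (caterpillar m) leaf))
    (hSn : S.labels.Nodup) (hTn : T.labels.Nodup) :
    e * 2 ^ (q + e) * ∑ j ∈ Finset.range (m + 1), j ≤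
      2 * (A.subproblems (unroot S) (unroot T)).ncard := by
  obtain ⟨⟨P, Q⟩, hp⟩ := A.rootings_nonempty S T
  obtain ⟨h₁, h₂⟩ := A.unroot_rootings _ _ _ hp
  obtain ⟨F, hF, hFn, hFP⟩ := exists_below_of_unroot_eq hS hSn h₁
  obtain ⟨G, hG, hGn, hGQ⟩ := exists_below_of_unroot_eq hT hTn h₂
  obtain ⟨D, hD, hD'⟩ := exists_finset_completeBinary
    (σ := A.strategy (unroot S) (unroot T)) (P := P) (Q := Q) hq hG hGn e hF hFn (by
      intro s t hs ht
      refine Relevant.start.of_below ?_ ?_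
      · rcases hs with rfl | hs
        · exact hFP
        · exact hs.trans hFP
      · rcases ht with rfl | ht
        · exact hGQ
        · exact ht.trans hGQ)
  refine hD.trans (Nat.mul_le_mul_left 2 ?_)
  rw [← Set.ncard_coe_finset]
  refine Set.ncard_le_ncard ?_ (A.finite_subproblems S T)
  intro p hp'
  obtain ⟨h₃, h₄, h₅, -⟩ := hD' p hp'
  exact ⟨h₄, h₅, (P, Q), hp, h₃⟩

theorem decomposition_lower_bound : ∃ c₁ c₂ c₃ : ℝ, 0 < c₁ ∧ 0 < c₂ ∧ 0 < c₃ ∧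
    ∀ (A : UnrootedDecomposition ℕ) (m n : ℕ), 1 ≤ m → m ≤ n →
      ∃ S T : RTree ℕ, S.labels.Nodup ∧ T.labels.Nodup ∧
        c₁ * n ≤ S.nodes ∧ (S.nodes : ℝ) ≤ c₂ * n ∧
        c₁ * m ≤ T.nodes ∧ (T.nodes : ℝ) ≤ c₂ * m ∧
        c₃ * ((m : ℝ) ^ 2 * n * (1 + Real.log ((n : ℝ) / m))) ≤
          ((A.subproblems (unroot S) (unroot T)).ncard : ℝ) := by
  refine ⟨1, 16, 1 / 8, by norm_num, by norm_num, by norm_num, fun A m n hm hmn => ?_⟩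
  -- `2 ^ q` is `m` and `2 ^ e` is `n / m`, both up to a factor of two, so that `2 ^ (q + e)` lies
  -- between `n` and `4 * n`.
  obtain ⟨q, hq₁, hq₂⟩ : ∃ q, m < 2 ^ q ∧ 2 ^ q ≤ 2 * m := by
    refine ⟨Nat.log 2 m + 1, Nat.lt_pow_succ_log_self (by norm_num) m, ?_⟩
    rw [pow_succ, mul_comm]
    exact Nat.mul_le_mul_left 2 (Nat.pow_log_le_self 2 (by omega))
  obtain ⟨e, he, he₁, he₂⟩ : ∃ e, 1 ≤ e ∧ n / m < 2 ^ e ∧ 2 ^ e ≤ 2 * (n / m) := by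
    have : n / m ≠ 0 := (Nat.div_pos hmn hm).ne'
    refine ⟨Nat.log 2 (n / m) + 1, by omega, Nat.lt_pow_succ_log_self (by norm_num) _, ?_⟩
    rw [pow_succ, mul_comm]
    exact Nat.mul_le_mul_left 2 (Nat.pow_log_le_self 2 this)
  have he₁' : n < 2 ^ e * m := by
    rwa [Nat.div_lt_iff_lt_mul hm] at he₁
  have hlow : n ≤ 2 ^ (q + e) := by
    rw [pow_add]
    nlinarith
  have hupp : 2 ^ (q + e) ≤ 4 * n := by
    have := Nat.div_mul_le_self n m
    calc 2 ^ (q + e) = 2 ^ q * 2 ^ e := pow_add _ _ _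
      _ ≤ 2 * m * (2 * (n / m)) := Nat.mul_le_mul hq₂ he₂
      _ = 4 * (n / m * m) := by ring
      _ ≤ 4 * n := by omega
  let s := cons () (completeBinary (q + e)) (cons () (completeBinary (q + e)) leaf)
  let t := cons () (caterpillar m) (cons () (caterpillar m) leaf)
  have hs : (number s 0).nodes + 1 = 4 * 2 ^ (q + e) := by
    have := edges_completeBinary (q + e)
    rw [pow_succ] at this
    simp only [nodes, edges_number, s, edges_cons, edges_leaf]
    omega
  have ht : (number t 0).nodes = 6 * m + 3 := by
    simp only [nodes, edges_number, t, edges_cons, edges_leaf, edges_caterpillar]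
    omega
  refine ⟨number s 0, number t 0, nodup_labels_number _ _, nodup_labels_number _ _, ?_, ?_, ?_, ?_,
    ?_⟩
  · rw [one_mul]
    exact_mod_cast (by omega : n ≤ (number s 0).nodes)
  · exact_mod_cast (by omega : (number s 0).nodes ≤ 16 * n)
  · rw [one_mul]
    exact_mod_cast (by omega : m ≤ (number t 0).nodes)
  · exact_mod_cast (by omega : (number t 0).nodes ≤ 16 * m)
  have hcard := A.le_ncard_subproblems hq₁ (map_number s 0) (map_number t 0)
    (nodup_labels_number _ _) (nodup_labels_number _ _)
  set K := (A.subproblems (unroot (number s 0)) (unroot (number t 0))).ncard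
  have hsum : (∑ j ∈ Finset.range (m + 1), j) * 2 = (m + 1) * m := Finset.sum_range_id_mul_two _
  have hK : e * n * (m * m) ≤ 4 * K := by
    calc e * n * (m * m) ≤ e * 2 ^ (q + e) * ((m + 1) * m) := by gcongr; omega
      _ = 2 * (e * 2 ^ (q + e) * ∑ j ∈ Finset.range (m + 1), j) := by rw [← hsum]; ring
      _ ≤ 4 * K := by omega
  have hK' : (e : ℝ) * n * (m * m) ≤ 4 * K := by exact_mod_cast hK
  have hm₀ : (0 : ℝ) < m := by exact_mod_cast hm
  have hn₀ : (0 : ℝ) < n := by exact_mod_cast hm.trans hmn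
  have hlog : Real.log ((n : ℝ) / m) ≤ e := by
    have h₁ : (n : ℝ) / m ≤ 2 ^ e := by
      rw [div_le_iff₀ hm₀]
      exact_mod_cast he₁'.le
    calc Real.log ((n : ℝ) / m) ≤ Real.log (2 ^ e) := Real.log_le_log (by positivity) h₁
      _ = e * Real.log 2 := by rw [Real.log_pow]
      _ ≤ e * 1 := by
        gcongr
        exact Real.log_two_lt_d9.le.trans (by norm_num)
      _ = e := mul_one _
  -- This absorbs the summand `1` next to the logarithm, also for `n = m`.
  have he' : (1 : ℝ) ≤ e := by exact_mod_cast he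
  have : (m : ℝ) ^ 2 * n * (1 + Real.log ((n : ℝ) / m)) ≤ (m : ℝ) ^ 2 * n * (2 * e) := by
    gcongr
    linarith
  nlinarith

end LowerBound


/-! ### The gadget on encoded instances -/

section Instances

/-- Extending a function by a value at a new last element. -/
def snocLabel {γ : Type*} {k : ℕ} (φ : Fin k → γ) (x : γ) : Fin (k + 1) → γ :=
  Fin.lastCases x φ

@[simp] theorem snocLabel_last {γ : Type*} {k : ℕ} (φ : Fin k → γ) (x : γ) :
    snocLabel φ x (Fin.last k) = x := by
  simp [snocLabel]

@[simp] theorem snocLabel_castSucc {γ : Type*} {k : ℕ} (φ : Fin k → γ) (x : γ) (a : Fin k) :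
    snocLabel φ x a.castSucc = φ a := by
  simp [snocLabel]

/-- The relabelling costs with a new last label, which can only be matched with itself. -/
def snocMtch {k : ℕ} (μ : Fin k → Fin k → ℕ∞) : Fin (k + 1) → Fin (k + 1) → ℕ∞ :=
  snocLabel (fun a => snocLabel (μ a) ⊤) (snocLabel (fun _ => ⊤) 0)

theorem snocMtch_symm {k : ℕ} {μ : Fin k → Fin k → ℕ∞} (h : ∀ a b, μ a b = μ b a)
    (a b : Fin (k + 1)) : snocMtch μ a b = snocMtch μ b a := by
  induction a using Fin.lastCases <;> induction b using Fin.lastCases <;> simp [snocMtch, h]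

/-- The tree with an additional edge that has a new label. -/
def snocTree {k : ℕ} (t : RTree (Fin k)) : RTree (Fin (k + 1)) :=
  cons (Fin.last k) (t.map Fin.castSucc) leaf

/-- The instance of the unrooted problem that is obtained by adding an edge with a new label. -/
def TEDInstance.addGadget (I : TEDInstance) : TEDInstance where
  k := I.k + 1
  S := snocTree I.S
  T := snocTree I.T
  del := snocLabel I.del ⊤
  mtch := snocMtch I.mtch
  mtch_symm := snocMtch_symm I.mtch_symm

theorem Costs.eq_of_forall {α : Type*} {c c' : Costs α} (h : ∀ a, c.del a = c'.del a)
    (h' : ∀ a b, c.mtch a b = c'.mtch a b) : c = c' := by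
  cases c
  cases c'
  simp only [Costs.mk.injEq]
  exact ⟨funext h, funext fun a => funext (h' a)⟩

theorem TEDInstance.costs_addGadget (I : TEDInstance) :
    I.addGadget.costs = (gadgetCosts I.costs).comap (finSuccEquivLast (n := I.k)) := by
  apply Costs.eq_of_forall
  · show ∀ a : Fin (I.k + 1), ((snocLabel I.del ⊤ a : ℕ∞) : ℝ≥0∞) =
      (gadgetCosts I.costs).del (finSuccEquivLast a)
    intro a
    induction a using Fin.lastCases <;> simp [gadgetCosts, costs]
  · show ∀ a b : Fin (I.k + 1), ((snocMtch I.mtch a b : ℕ∞) : ℝ≥0∞) =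
      (gadgetCosts I.costs).mtch (finSuccEquivLast a) (finSuccEquivLast b)
    intro a b
    induction a using Fin.lastCases <;> induction b using Fin.lastCases <;>
      simp [snocMtch, gadgetCosts, costs]

theorem map_snocTree {k : ℕ} (t : RTree (Fin k)) :
    (snocTree t).map finSuccEquivLast = gadget t := by
  simp only [snocTree, gadget, map_cons, map_leaf, finSuccEquivLast_last, map_map]
  congr 2
  funext a
  simp

theorem unrootedDist_snocTree {k : ℕ} (c : Costs (Fin k)) (S T : RTree (Fin k)) :
    unrootedDist ((gadgetCosts c).comap finSuccEquivLast) (unroot (snocTree S))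
      (unroot (snocTree T)) = rootedDist c S T := by
  rw [← unrootedDist_map_equiv, map_snocTree, map_snocTree, unrootedDist_gadget]

theorem TEDInstance.dist_addGadget (I : TEDInstance) :
    I.addGadget.dist .unrooted = I.dist .rooted :=
  (congrArg (fun c => unrootedDist c (unroot I.addGadget.S) (unroot I.addGadget.T))
    I.costs_addGadget).trans (unrootedDist_snocTree I.costs I.S I.T)

theorem TEDInstance.size_addGadget (I : TEDInstance) : I.addGadget.size = I.size + 1 := by
  simp [size, addGadget, snocTree, nodes]

theorem TEDInstance.one_le_size (I : TEDInstance) : 1 ≤ I.size :=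
  le_max_of_le_left (Nat.le_add_left 1 _)

theorem treeCode_map_castSucc {k : ℕ} (t : RTree (Fin k)) :
    treeCode (t.map Fin.castSucc) = treeCode t := by
  induction t with
  | leaf => rfl
  | cons a s r ih₁ ih₂ => simp [treeCode, ih₁, ih₂]

/-- The code is in postorder and the new edge is the only one at the new root, so its entries come
last; the new label `k` leaves the old labels unchanged. -/
theorem treeCode_snocTree {k : ℕ} (t : RTree (Fin k)) :
    treeCode (snocTree t) = treeCode t ++ [k] ++ [t.edges] := by
  simp [snocTree, treeCode, treeCode_map_castSucc]

theorem length_treeCode {k : ℕ} (t : RTree (Fin k)) : (treeCode t).length = 2 * t.edges := by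
  induction t with
  | leaf => rfl
  | cons a s r ih₁ ih₂ => simp [treeCode, ih₁, ih₂]; ring

/-- The code of the contraction costs. -/
def delCode {k : ℕ} (δ : Fin k → ℕ∞) : List ℕ := List.ofFn fun a => costCode (δ a)

/-- The code of the relabelling costs. -/
def mtchCode {k : ℕ} (μ : Fin k → Fin k → ℕ∞) : List ℕ :=
  (List.finRange k).flatMap fun a : Fin k =>
    List.ofFn fun b : Fin ((a : ℕ) + 1) => costCode (μ a (Fin.castLE a.isLt b))

theorem TEDInstance.encode_eq (I : TEDInstance) :
    I.encode = [treeCode I.S, treeCode I.T, delCode I.del, mtchCode I.mtch] := rfl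

theorem length_delCode {k : ℕ} (δ : Fin k → ℕ∞) : (delCode δ).length = k :=
  List.length_ofFn

theorem delCode_snocLabel {k : ℕ} (δ : Fin k → ℕ∞) :
    delCode (snocLabel δ ⊤) = delCode δ ++ [0] := by
  rw [delCode, List.ofFn_succ']
  simp [delCode, costCode]

/-- In a lower triangle the new label adds only a last row: `k` times `∞`, with code `0`, and the
cost `0`, with code `1`. -/
theorem mtchCode_snocMtch {k : ℕ} (μ : Fin k → Fin k → ℕ∞) :
    mtchCode (snocMtch μ) = mtchCode μ ++ List.replicate k 0 ++ [1] := by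
  rw [mtchCode, List.finRange_succ_last, List.flatMap_append, List.append_assoc]
  congr 1
  · rw [List.flatMap_map, mtchCode]
    congr 1
    funext a
    show List.ofFn (fun b : Fin ((a : ℕ) + 1) =>
      costCode (snocMtch μ a.castSucc (Fin.castLE a.isLt b : Fin k).castSucc)) = _
    simp only [snocMtch, snocLabel_castSucc]
  · simp only [List.flatMap_cons, List.flatMap_nil, List.append_nil]
    show List.ofFn (fun b : Fin (k + 1) => costCode (snocMtch μ (Fin.last k) b)) = _
    rw [List.ofFn_succ']
    simp [snocMtch, costCode, List.ofFn_const]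

theorem TEDInstance.encode_addGadget (I : TEDInstance) : I.addGadget.encode =
    [treeCode I.S ++ [I.k] ++ [I.S.edges], treeCode I.T ++ [I.k] ++ [I.T.edges],
      delCode I.del ++ [0], mtchCode I.mtch ++ List.replicate I.k 0 ++ [1]] := by
  rw [← treeCode_snocTree, ← treeCode_snocTree, ← delCode_snocLabel, ← mtchCode_snocMtch]
  rfl

end Instances

/-! ### Executing the conversion on the word RAM -/

section Machine

/-- The state in which registers and arrays have the listed contents, and are zero beyond. -/
def listState (regs : List ℕ) (arrs : List (List ℕ)) : RAMState where
  reg k := regs.getD k 0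
  mem k i := (arrs.getD k []).getD i 0

theorem listState_setReg (regs : List ℕ) (arrs : List (List ℕ)) {r : ℕ} (hr : r < regs.length)
    (x : ℕ) : (listState regs arrs).setReg r x = listState (regs.set r x) arrs := by
  simp only [RAMState.setReg, listState, RAMState.mk.injEq, and_true]
  funext k
  by_cases h : k = r
  · subst h
    simp [List.getD_eq_getElem?_getD, hr]
  · simp [Function.update_of_ne h, List.getD_eq_getElem?_getD, List.getElem?_set_ne (Ne.symm h)]

theorem getD_concat (l : List ℕ) (x : ℕ) :
    (fun i => (l ++ [x]).getD i 0) = Function.update (fun i => l.getD i 0) l.length x := by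
  funext i
  rcases lt_trichotomy i l.length with h | rfl | h
  · simp [Function.update_of_ne h.ne, List.getD_eq_getElem?_getD, List.getElem?_append_left h]
  · simp [List.getD_eq_getElem?_getD]
  · rw [Function.update_of_ne h.ne', List.getD_eq_default _ _ (by simpa using h),
      List.getD_eq_default _ _ h.le]

theorem listState_setMem (regs : List ℕ) (arrs : List (List ℕ)) {a : ℕ} (ha : a < arrs.length)
    (x : ℕ) : (listState regs arrs).setMem a (arrs.getD a []).length x =
      listState regs (arrs.set a (arrs.getD a [] ++ [x])) := by
  simp only [RAMState.setMem, listState, RAMState.mk.injEq, true_and]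
  funext k
  by_cases h : k = a
  · subst h
    rw [Function.update_self, ← getD_concat]
    simp [List.getD_eq_getElem?_getD, ha]
  · simp [Function.update_of_ne h, List.getD_eq_getElem?_getD, List.getElem?_set_ne (Ne.symm h)]

theorem getD_append_replicate_zero (l : List ℕ) (n i : ℕ) :
    (l ++ List.replicate n 0).getD i 0 = l.getD i 0 := by
  rcases lt_or_ge i l.length with h | h
  · simp [List.getD_eq_getElem?_getD, List.getElem?_append_left h]
  · rw [List.getD_eq_default _ _ h, List.getD_eq_getElem?_getD, List.getElem?_append_right h]
    rcases lt_or_ge (i - l.length) n with h' | h' <;> simp [h']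

/-- Infinite costs at the ends of the arrays are already there, so a whole row of them costs no
time. -/
theorem listState_replicate (regs A B D M : List ℕ) (n : ℕ) :
    listState regs [A, B, D ++ [0], M ++ List.replicate n 0] = listState regs [A, B, D, M] := by
  simp only [listState, RAMState.mk.injEq, true_and]
  funext k i
  rcases k with _ | _ | _ | _ | k
  · rfl
  · rfl
  · exact getD_append_replicate_zero D 1 i
  · exact getD_append_replicate_zero M n i
  · rfl

theorem initState_eq_listState (A B D M : List ℕ) : initState [A, B, D, M] =
    listState [A.length, B.length, D.length, M.length, 0, 0] [A, B, D, M] := by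
  simp only [initState, listState, RAMState.mk.injEq, and_true]
  funext k
  rcases k with _ | _ | _ | _ | _ | _ | k <;> rfl

theorem Exec.const_list {W : ℕ} {regs : List ℕ} {arrs : List (List ℕ)} (r v : ℕ)
    (hr : r < regs.length) (hv : v < 2 ^ W) :
    Exec W (.const r v) (listState regs arrs) 1 (listState (regs.set r v) arrs) := by
  rw [← listState_setReg _ _ hr]
  simpa only [Nat.mod_eq_of_lt hv] using Exec.const (W := W) r v (listState regs arrs)

theorem Exec.op_list {W : ℕ} {regs : List ℕ} {arrs : List (List ℕ)} (o : BinOp) (r x y : ℕ)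
    {v : ℕ} (hr : r < regs.length) (hv : o.eval W (regs.getD x 0) (regs.getD y 0) = v) :
    Exec W (.op o r x y) (listState regs arrs) 1 (listState (regs.set r v) arrs) := by
  rw [← listState_setReg _ _ hr, ← hv]
  exact Exec.op o r x y (listState regs arrs)

theorem Exec.store_list {W : ℕ} {regs : List ℕ} {arrs : List (List ℕ)} (a i r : ℕ)
    (ha : a < arrs.length) (hi : regs.getD i 0 = (arrs.getD a []).length) :
    Exec W (.store a i r) (listState regs arrs) 1
      (listState regs (arrs.set a (arrs.getD a [] ++ [regs.getD r 0]))) := by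
  rw [← listState_setMem _ _ ha, ← hi]
  exact Exec.store a i r (listState regs arrs)

theorem BinOp.eval_add {W x y v : ℕ} (h : x + y = v) (hv : v < 2 ^ W) :
    BinOp.eval W .add x y = v := by
  subst h
  exact Nat.mod_eq_of_lt hv

theorem BinOp.eval_div {W x y v : ℕ} (h : x / y = v) (hv : v < 2 ^ W) :
    BinOp.eval W .div x y = v := by
  subst h
  exact Nat.mod_eq_of_lt hv

/-- Appending the code of a root edge to the code of a tree; the register `2` holds the label and
the register `4` holds `1`. -/
def addRootEdge (a : ℕ) : Program :=
  .seq (.const 5 2) <| .seq (.op .div 5 a 5) <| .seq (.store a a 2) <| .seq (.op .add a a 4) <|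
    .seq (.store a a 5) (.op .add a a 4)

/-- The transformation of the code of an instance into the code of the instance with the
additional edges. -/
def addGadgetProgram : Program :=
  .seq (.const 4 1) <| .seq (addRootEdge 0) <| .seq (addRootEdge 1) <|
    .seq (.op .add 3 3 2) <| .seq (.store 3 3 4) <| .seq (.op .add 3 3 4) <|
    .seq (.op .add 2 2 4) <| .seq (.const 4 0) (.const 5 0)

theorem exec_addRootEdge_zero {W e k t x b : ℕ} {A B D M : List ℕ} (hA : A.length = 2 * e)
    (hW : 2 * e + 2 < 2 ^ W) :
    Exec W (addRootEdge 0) (listState [2 * e, b, k, t, 1, x] [A, B, D, M]) 6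
      (listState [2 * e + 2, b, k, t, 1, e] [A ++ [k] ++ [e], B, D, M]) := by
  refine (Exec.const_list 5 2 (by simp) (by omega)).seq <|
    -- Every edge takes two words, so halving the length of the code gives the number of edges below
    -- the new one.
    (Exec.op_list .div 5 0 5 (v := e) (by simp) (BinOp.eval_div (by simp) (by omega))).seq <|
    (Exec.store_list 0 0 2 (by simp) (by simp [hA])).seq <|
    (Exec.op_list .add 0 0 4 (v := 2 * e + 1) (by simp)
      (BinOp.eval_add (by simp) (by omega))).seq <|
    (Exec.store_list 0 0 5 (by simp) (by simp [hA])).seq <|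
    (Exec.op_list .add 0 0 4 (v := 2 * e + 2) (by simp) (BinOp.eval_add (by simp) (by omega)))

theorem exec_addRootEdge_one {W e k t x a : ℕ} {A B D M : List ℕ} (hB : B.length = 2 * e)
    (hW : 2 * e + 2 < 2 ^ W) :
    Exec W (addRootEdge 1) (listState [a, 2 * e, k, t, 1, x] [A, B, D, M]) 6
      (listState [a, 2 * e + 2, k, t, 1, e] [A, B ++ [k] ++ [e], D, M]) := by
  refine (Exec.const_list 5 2 (by simp) (by omega)).seq <|
    (Exec.op_list .div 5 1 5 (v := e) (by simp) (BinOp.eval_div (by simp) (by omega))).seq <|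
    (Exec.store_list 1 1 2 (by simp) (by simp [hB])).seq <|
    (Exec.op_list .add 1 1 4 (v := 2 * e + 1) (by simp)
      (BinOp.eval_add (by simp) (by omega))).seq <|
    (Exec.store_list 1 1 5 (by simp) (by simp [hB])).seq <|
    (Exec.op_list .add 1 1 4 (v := 2 * e + 2) (by simp) (BinOp.eval_add (by simp) (by omega)))

theorem length_le_magnitude (xs : List (List ℕ)) : xs.flatten.length ≤ magnitude xs :=
  Nat.le_add_right _ _

theorem le_foldr_max {l : List ℕ} {x : ℕ} (h : x ∈ l) : x ≤ l.foldr max 0 := by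
  induction l with
  | nil => simp at h
  | cons a l ih =>
    rcases List.mem_cons.1 h with rfl | h
    · exact le_max_left _ _
    · exact (ih h).trans (le_max_right _ _)

theorem foldr_max_le {l : List ℕ} {b : ℕ} (h : ∀ x ∈ l, x ≤ b) : l.foldr max 0 ≤ b := by
  induction l with
  | nil => simp
  | cons a l ih =>
    exact max_le (h a (by simp)) (ih fun x hx => h x (by simp [hx]))

theorem le_magnitude {xs : List (List ℕ)} {x : ℕ} (h : x ∈ xs.flatten) : x ≤ magnitude xs :=
  (le_foldr_max h).trans (Nat.le_add_left _ _)

theorem TEDInstance.lengths_le_magnitude (I : TEDInstance) :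
    2 * I.S.edges + (2 * I.T.edges + (I.k + (mtchCode I.mtch).length)) ≤ magnitude I.encode := by
  have h := length_le_magnitude I.encode
  simpa [encode_eq, length_treeCode, length_delCode] using h

theorem TEDInstance.magnitude_addGadget_le (I : TEDInstance) :
    magnitude I.addGadget.encode ≤ 3 * magnitude I.encode + 7 := by
  have hl := I.lengths_le_magnitude
  have h₁ : I.addGadget.encode.flatten.length ≤ 2 * magnitude I.encode + 6 := by
    rw [encode_addGadget]
    simp only [List.flatten_cons, List.flatten_nil, List.length_append, List.length_cons,
      List.length_nil, List.length_replicate, length_treeCode, length_delCode]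
    omega
  have h₂ : I.addGadget.encode.flatten.foldr max 0 ≤ magnitude I.encode + 1 := by
    refine foldr_max_le fun x hx => ?_
    by_cases h : x ∈ I.encode.flatten
    · exact (le_magnitude h).trans (Nat.le_succ _)
    · rw [encode_addGadget] at hx
      simp only [encode_eq, List.flatten_cons, List.flatten_nil, List.mem_append, List.mem_cons,
        List.not_mem_nil, or_false, List.mem_replicate] at hx h
      have : x = I.k ∨ x = I.S.edges ∨ x = I.T.edges ∨ x = 0 ∨ x = 1 := by tauto
      omega
  unfold magnitude at h₁ h₂ ⊢
  omega

theorem TEDInstance.exec_addGadgetProgram (I : TEDInstance) {W : ℕ}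
    (hW : magnitude I.encode + 2 < 2 ^ W) :
    Exec W addGadgetProgram (initState I.encode) 19 (initState I.addGadget.encode) := by
  have hl := I.lengths_le_magnitude
  -- The registers `4` and `5` are cleared at the end, as the given program must start exactly in
  -- its initial state.
  have hend : initState I.addGadget.encode =
      listState [2 * I.S.edges + 2, 2 * I.T.edges + 2, I.k + 1, (mtchCode I.mtch).length + I.k + 1, 0, 0]
        I.addGadget.encode := by
    rw [encode_addGadget, initState_eq_listState]
    simp [length_treeCode, length_delCode, add_assoc]
  rw [hend, encode_addGadget, encode_eq, initState_eq_listState, length_treeCode, length_treeCode,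
    length_delCode, ← listState_replicate _ _ _ _ _ I.k]
  generalize hA : treeCode I.S = A
  generalize hB : treeCode I.T = B
  generalize delCode I.del ++ [0] = D
  generalize hM : mtchCode I.mtch = M at hl
  have hA' : A.length = 2 * I.S.edges := hA ▸ length_treeCode I.S
  have hB' : B.length = 2 * I.T.edges := hB ▸ length_treeCode I.T
  generalize I.S.edges = a at hl hA'
  generalize I.T.edges = b at hl hB'
  generalize I.k = k at hl
  have h₁ : Exec W (.const 4 1)
      (listState [2 * a, 2 * b, k, M.length, 0, 0] [A, B, D, M ++ List.replicate k 0]) 1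
      (listState [2 * a, 2 * b, k, M.length, 1, 0] [A, B, D, M ++ List.replicate k 0]) :=
    Exec.const_list 4 1 (by simp) (by omega)
  have h₂ := exec_addRootEdge_zero (W := W) (k := k) (t := M.length) (x := 0) (b := 2 * b) (B := B)
    (D := D) (M := M ++ List.replicate k 0) hA' (by omega)
  have h₃ := exec_addRootEdge_one (W := W) (k := k) (t := M.length) (x := a) (a := 2 * a + 2)
    (A := A ++ [k] ++ [a]) (D := D) (M := M ++ List.replicate k 0) hB' (by omega)
  generalize A ++ [k] ++ [a] = A' at *
  generalize B ++ [k] ++ [b] = B' at *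
  generalize 2 * a + 2 = a' at *
  generalize 2 * b + 2 = b' at *
  have h₄ : Exec W (.op .add 3 3 2)
      (listState [a', b', k, M.length, 1, b] [A', B', D, M ++ List.replicate k 0]) 1
      (listState [a', b', k, M.length + k, 1, b] [A', B', D, M ++ List.replicate k 0]) :=
    Exec.op_list .add 3 3 2 (by simp) (BinOp.eval_add (by simp) (by omega))
  have h₅ : Exec W (.store 3 3 4)
      (listState [a', b', k, M.length + k, 1, b] [A', B', D, M ++ List.replicate k 0]) 1
      (listState [a', b', k, M.length + k, 1, b] [A', B', D, M ++ List.replicate k 0 ++ [1]]) :=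
    Exec.store_list 3 3 4 (by simp) (by simp)
  generalize M ++ List.replicate k 0 ++ [1] = M' at *
  have h₆ : Exec W (.op .add 3 3 4) (listState [a', b', k, M.length + k, 1, b] [A', B', D, M']) 1
      (listState [a', b', k, M.length + k + 1, 1, b] [A', B', D, M']) :=
    Exec.op_list .add 3 3 4 (by simp) (BinOp.eval_add (by simp) (by omega))
  have h₇ : Exec W (.op .add 2 2 4)
      (listState [a', b', k, M.length + k + 1, 1, b] [A', B', D, M']) 1
      (listState [a', b', k + 1, M.length + k + 1, 1, b] [A', B', D, M']) :=
    Exec.op_list .add 2 2 4 (by simp) (BinOp.eval_add (by simp) (by omega))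
  have h₈ : Exec W (.const 4 0) (listState [a', b', k + 1, M.length + k + 1, 1, b] [A', B', D, M'])
      1 (listState [a', b', k + 1, M.length + k + 1, 0, b] [A', B', D, M']) :=
    Exec.const_list 4 0 (by simp) (by omega)
  have h₉ : Exec W (.const 5 0) (listState [a', b', k + 1, M.length + k + 1, 0, b] [A', B', D, M'])
      1 (listState [a', b', k + 1, M.length + k + 1, 0, 0] [A', B', D, M']) :=
    Exec.const_list 5 0 (by simp) (by omega)
  exact h₁.seq (h₂.seq (h₃.seq (h₄.seq (h₅.seq (h₆.seq (h₇.seq (h₈.seq h₉)))))))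

end Machine

/-! ### Transfer of running times -/

section Reduction

theorem TEDInstance.log2_magnitude_addGadget_le (I : TEDInstance) :
    Nat.log2 (magnitude I.addGadget.encode) + 1 ≤ 4 * (Nat.log2 (magnitude I.encode) + 1) := by
  have h₁ : magnitude I.encode < 2 ^ (Nat.log2 (magnitude I.encode) + 1) := Nat.lt_log2_self
  have h₂ := I.magnitude_addGadget_le
  set l := Nat.log2 (magnitude I.encode)
  have h₃ : 1 ≤ 2 ^ l := Nat.one_le_two_pow
  rcases Nat.eq_zero_or_pos (magnitude I.addGadget.encode) with h₀ | h₀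
  · rw [h₀, Nat.log2_zero]
    omega
  · have h₄ : magnitude I.addGadget.encode < 2 ^ (l + 4) := by
      rw [pow_succ] at h₁
      rw [pow_add]
      omega
    have := (Nat.log2_lt h₀.ne').2 h₄
    omega

theorem TEDInstance.magnitude_lt_of_le (I : TEDInstance) {W : ℕ}
    (h : 5 * (Nat.log2 (magnitude I.encode) + 1) ≤ W) : magnitude I.encode + 2 < 2 ^ W := by
  have h₁ : magnitude I.encode < 2 ^ (Nat.log2 (magnitude I.encode) + 1) := Nat.lt_log2_self
  set l := Nat.log2 (magnitude I.encode)
  have h₂ : 2 ^ (l + 1 + 2) ≤ 2 ^ W := Nat.pow_le_pow_right (by norm_num) (by omega)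
  have h₃ : 1 ≤ 2 ^ (l + 1) := Nat.one_le_two_pow
  rw [pow_add] at h₂
  omega

theorem solvableIn_rooted_of_unrooted {t : ℕ → ℝ} {f g : ℕ → ℕ} {d : ℕ} (ht : ∀ n, 0 ≤ t n)
    (hfg : ∀ n, f n + 1 ≤ g (n + 1)) (h : (ted .unrooted g d).SolvableIn t) :
    (ted .rooted f d).SolvableIn fun n => t (n + 1) + n + f n := by
  obtain ⟨p, k, C, hk, h⟩ := h
  -- The new logarithmic term is at most `4` times the old one, and `5` also suffices to exclude
  -- overflow during the conversion. The `19` pays for its steps, as the size is at least `1`; `|C|`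
  -- is used because `C` may be negative.
  refine ⟨.seq addGadgetProgram p, 5 * k, |C| + 19, by omega, ?_⟩
  rintro ⟨I, hIk, hdel, hmtch⟩ W hW
  have hW' : 5 * k * (Nat.log2 (magnitude I.encode) + 1) ≤ W := hW
  have hpow : (I.size : ℕ∞) ^ d ≤ ((I.size + 1 : ℕ) : ℕ∞) ^ d :=
    pow_le_pow_left' (by exact_mod_cast Nat.le_succ _) d
  obtain ⟨T, s, hT, ⟨x, hx, hs⟩, hC⟩ := h ⟨I.addGadget, by
      rw [I.size_addGadget]
      exact (Nat.add_le_add_right hIk 1).trans (hfg _), by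
      rw [I.size_addGadget]
      intro a
      refine Fin.lastCases (.inl ?_) (fun a => ?_) a
      · simp [TEDInstance.addGadget, snocMtch]
      · simpa [TEDInstance.addGadget, snocMtch] using (hdel a).imp_right fun h => h.trans hpow, by
      rw [I.size_addGadget]
      intro a b
      refine Fin.lastCases (Fin.lastCases (.inr ?_) (fun b => .inl ?_) b)
        (fun a => Fin.lastCases (.inl ?_) (fun b => ?_) b) a
      · simp [TEDInstance.addGadget, snocMtch]
      · simp [TEDInstance.addGadget, snocMtch]
      · simp [TEDInstance.addGadget, snocMtch]
      · simpa [TEDInstance.addGadget, snocMtch] using (hmtch a b).imp_right fun h => h.trans hpow⟩ W (by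
      calc k * (Nat.log2 (magnitude I.addGadget.encode) + 1)
          ≤ k * (4 * (Nat.log2 (magnitude I.encode) + 1)) :=
            Nat.mul_le_mul_left k I.log2_magnitude_addGadget_le
        _ ≤ 5 * k * (Nat.log2 (magnitude I.encode) + 1) := by nlinarith
        _ ≤ W := hW')
  refine ⟨19 + T, s, (I.exec_addGadgetProgram (I.magnitude_lt_of_le ?_)).seq hT,
    ⟨x, by rw [← hx]; exact I.dist_addGadget.symm, hs⟩, ?_⟩
  · refine le_trans ?_ hW'
    gcongr
    omega
  · have hC' : (T : ℝ) ≤ C * t (I.size + 1) := by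
      rw [← I.size_addGadget]
      exact hC
    show ((19 + T : ℕ) : ℝ) ≤ (|C| + 19) * (t (I.size + 1) + I.size + f I.size)
    have h₁ : (1 : ℝ) ≤ I.size := by exact_mod_cast I.one_le_size
    have h₂ : C * t (I.size + 1) ≤ |C| * t (I.size + 1) :=
      mul_le_mul_of_nonneg_right (le_abs_self C) (ht _)
    have h₃ : 0 ≤ |C| * (I.size + f I.size : ℝ) := by positivity
    have h₄ : (0 : ℝ) ≤ f I.size := by positivity
    have h₅ := ht (I.size + 1)
    push_cast
    nlinarith

theorem Problem.SolvableIn.mono {P : Problem} {t t' : ℕ → ℝ} (h : P.SolvableIn t) (K : ℝ)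
    (ht : ∀ x, 0 ≤ t (P.size x)) (hK : ∀ x, t (P.size x) ≤ K * t' (P.size x)) :
    P.SolvableIn t' := by
  obtain ⟨p, k, C, hk, h⟩ := h
  refine ⟨p, k, |C| * K, hk, fun x W hW => ?_⟩
  obtain ⟨T, s, hT, hs, hC⟩ := h x W hW
  refine ⟨T, s, hT, hs, hC.trans ?_⟩
  calc C * t (P.size x) ≤ |C| * t (P.size x) :=
        mul_le_mul_of_nonneg_right (le_abs_self C) (ht x)
    _ ≤ |C| * (K * t' (P.size x)) := mul_le_mul_of_nonneg_left (hK x) (abs_nonneg C)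
    _ = |C| * K * t' (P.size x) := by ring

theorem subcubic_rooted_of_unrooted {f g : ℕ → ℕ} (hfg : ∀ n, f n + 1 ≤ g (n + 1)) (k : ℕ)
    (hf : ∀ n, 1 ≤ n → f n ≤ k * n) (h : SubcubicTED .unrooted g) : SubcubicTED .rooted f := by
  intro d
  obtain ⟨ε, hε, h⟩ := h d
  -- Capping `ε` at `2` keeps the exponent at least `1`, so that the additive terms `n` and `f n`
  -- are absorbed. Going from `n + 1` to `n` costs at most the factor `2 ^ 3 = 8`.
  refine ⟨min ε 2, lt_min hε two_pos, ?_⟩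
  refine (solvableIn_rooted_of_unrooted (fun n => by positivity) hfg h).mono (8 + 1 + k)
    (fun x => by positivity) fun x => ?_
  have hn : 1 ≤ (ted .rooted f d).size x := x.1.one_le_size
  generalize (ted .rooted f d).size x = n at hn
  have hn' : (1 : ℝ) ≤ n := by exact_mod_cast hn
  have h₁ : ((n + 1 : ℕ) : ℝ) ^ (3 - ε) ≤ 8 * (n : ℝ) ^ (3 - min ε 2) := by
    calc ((n + 1 : ℕ) : ℝ) ^ (3 - ε) ≤ ((n + 1 : ℕ) : ℝ) ^ (3 - min ε 2) :=
          Real.rpow_le_rpow_of_exponent_le (by push_cast; linarith)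
            (sub_le_sub_left (min_le_left _ _) _)
      _ ≤ (2 * n : ℝ) ^ (3 - min ε 2) :=
          Real.rpow_le_rpow (by positivity) (by push_cast; linarith)
            (by linarith [min_le_right ε 2])
      _ = 2 ^ (3 - min ε 2) * (n : ℝ) ^ (3 - min ε 2) :=
          Real.mul_rpow (by norm_num) (by positivity)
      _ ≤ 2 ^ (3 : ℝ) * (n : ℝ) ^ (3 - min ε 2) := by
          gcongr
          · norm_num
          · linarith [lt_min hε two_pos]
      _ = 8 * (n : ℝ) ^ (3 - min ε 2) := by norm_num
  have h₂ : (n : ℝ) ≤ (n : ℝ) ^ (3 - min ε 2) := by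
    conv_lhs => rw [← Real.rpow_one (n : ℝ)]
    exact Real.rpow_le_rpow_of_exponent_le hn' (by linarith [min_le_right ε 2])
  have h₃ : (f n : ℝ) ≤ k * n := by exact_mod_cast hf n hn
  have h₄ : (k : ℝ) * n ≤ k * (n : ℝ) ^ (3 - min ε 2) := by gcongr
  linarith

end Reduction

end TreeEdit

theorem mainTheorem3 :
    -- the reduction, for arbitrary rooted trees and costs
    (∀ (α : Type) (c : Costs α) (S T : RTree α),
      unrootedDist (gadgetCosts c) (unroot (gadget S)) (unroot (gadget T)) = rootedDist c S T ∧
      ∀ M' N' : Marked (Option α),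
        IsOptimalUnrooted (gadgetCosts c) (unroot (gadget S)) (unroot (gadget T)) M' N' →
        editCost (gadgetCosts c) M' N' ≠ ⊤ →
        (none, none) ∈ matched M' N' ∧
        ∃ M N : Marked α,
          unroot M' = unroot (markedGadget M) ∧ unroot N' = unroot (markedGadget N) ∧
          (matched M' N').Perm ((none, none) :: (matched M N).map (Prod.map some some)) ∧
          IsOptimalRooted c S T M N ∧
          editCost c M N = editCost (gadgetCosts c) M' N') ∧
    -- the lower bound for decomposition algorithms
    (∃ c₁ c₂ c₃ : ℝ, 0 < c₁ ∧ 0 < c₂ ∧ 0 < c₃ ∧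
      ∀ (A : UnrootedDecomposition ℕ) (m n : ℕ), 1 ≤ m → m ≤ n →
        ∃ S T : RTree ℕ, S.labels.Nodup ∧ T.labels.Nodup ∧
          c₁ * n ≤ S.nodes ∧ (S.nodes : ℝ) ≤ c₂ * n ∧
          c₁ * m ≤ T.nodes ∧ (T.nodes : ℝ) ≤ c₂ * m ∧
          c₃ * ((m : ℝ) ^ 2 * n * (1 + Real.log ((n : ℝ) / m))) ≤
            ((A.subproblems (unroot S) (unroot T)).ncard : ℝ)) ∧
    -- every time bound for unrooted trees gives one for rooted trees
    (∀ (t : ℕ → ℝ) (f g : ℕ → ℕ) (d : ℕ), (∀ n, 0 ≤ t n) → (∀ n, f n + 1 ≤ g (n + 1)) →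
      (ted .unrooted g d).SolvableIn t →
      (ted .rooted f d).SolvableIn fun n => t (n + 1) + n + f n) ∧
    -- truly subcubic algorithms: alphabets of linear and of constant size
    (∀ k : ℕ, 1 ≤ k →
      (SubcubicTED .unrooted (fun n => k * n) → SubcubicTED .rooted (fun n => k * n)) ∧
      (APSPHard .rooted (fun n => k * n) → APSPHard .unrooted (fun n => k * n))) ∧
    (∀ k : ℕ,
      (SubcubicTED .unrooted (fun _ => k + 1) → SubcubicTED .rooted (fun _ => k)) ∧
      (CliqueHard .rooted (fun _ => k) → CliqueHard .unrooted (fun _ => k + 1))) := by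
  refine ⟨fun α c S T => ⟨unrootedDist_gadget c S T, optimal_unrooted_gadget c S T⟩,
    decomposition_lower_bound, fun t f g d ht hfg h => solvableIn_rooted_of_unrooted ht hfg h,
    fun k hk => ?_, fun k => ?_⟩
  -- The additional node raises the bound on the alphabet by `k ≥ 1`, which makes room for `$`.
  · have h : SubcubicTED .unrooted (fun n => k * n) → SubcubicTED .rooted (fun n => k * n) :=
      subcubic_rooted_of_unrooted (fun n => by rw [Nat.mul_succ]; omega) k fun _ _ => le_rfl
    exact ⟨h, fun hr hu => hr (h hu)⟩
  · have h : SubcubicTED .unrooted (fun _ => k + 1) → SubcubicTED .rooted (fun _ => k) :=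
      subcubic_rooted_of_unrooted (fun _ => le_rfl) k fun n hn => Nat.le_mul_of_pos_right k hn
    exact ⟨h, fun hr hu => hr (h hu)⟩
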